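/- Let $F=\begin{pmatrix}k&l\\ m&n\end{pmatrix}\in GL(2,\mathbb Z)$ be a hyperbolic matrix with non-negative entries, let $(s_1,s_2)^T$ be a column eigenvector and $(u_1,u_2)$ a row eigenvector of $F$ with positive entries, and put $p=k+m$, $r=l+n$. Let $L\subset\mathbb R^2$ be the lattice with basis $e_0=(s_2,u_1)$, $f_0=(-s_1,u_2)$, and let $\mathcal F$ be the automorphism of the torus $\mathbb R^2/L$ that is given by $F$ in this basis. The rectangles $R_1=[0,s_1]\times[0,u_1]$ and $R_2=[-s_2,0]\times[0,u_2]$ form a bi-partition of the torus with the horizontal spine $J^s=[-s_2,s_1]\times\{0\}$ and the vertical spine $J^u=\{0\}\times[0,u_1+u_2]$. A translate of it by $v$ is a Berg partition if $\mathcal F(J^s+v)\subset J^s+v$ and $\mathcal F(J^u+v)\supset J^u+v$ in the torus. Its connectivity matrix has as its $(i,j)$ entry the number of connected components of $\mathcal F(\operatorname{int}R_i+v)\cap(\operatorname{int}R_j+v)$. A vertical line through a point $(x,0)\in J^s$ is cut by the $L$-translates of $R_1,R_2$ into tiles of types $a,b$; this gives a bi-infinite word $\omega\in\{a,b\}^{\mathbb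 Z}$ in which $\omega_0$ is the tile with lower endpoint $(x,0)$ (an intersection tiling, or Sturmian word associated with $F$; lines through lattice translates of $J^u$ may be read on either side). The two principal tilings $\omega^{ab}$, $\omega^{ba}$ are those of $x=0$; they begin at place $0$ with the lock $ab$, respectively $ba$. The standard substitution $\sigma_{\rm st}$ sends $a$ to the first $p$ letters, from place $0$ on, of $\omega^{ab}$ and $b$ to the first $r$ letters of $\omega^{ba}$ if $\det F=1$; if $\det F=-1$ the two tilings are exchanged. Say that a Berg partition, the translate by $v$, realizes a substitution $\sigma$ if for $c=a$ (rectangle $R_1$) and $c=b$ (rectangle $R_2$) the $\mathcal F$-image of every vertical segment crossing the interior of $R_1+v$, respectively $R_2+v$, from bottom to top is cut by the partition into the tiles of the word $\sigma(c)$, read upwards. Then there are exactly $N=p+r-1=k+l+m+n-1$ points $(0,t)\in J^u$ such that placing the origin there (i.e. translating the bi-partition by $(0,-t)$) gives a Berg partition; call them $(0,t_0),\dots,(0,t_{N-1})$ with $t_0<\dots<t_{N-1}$. For each $i$: 1. The $i$-th Berg partition has connectivity matrix $F^T$ and realizes exactly one substitution $\sigma_i$. The substitutions $\sigma_0,\dots,\sigma_{N-1}$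 are pairwise distinct. 2. If $\omega$ is the principal tiling with lock $ab$ when $\det F=1$, and with lock $ba$ when $\det F=-1$, then $\sigma_i(a)=\omega_{-i}\cdots\omega_{-i+p-1}$ and $\sigma_i(b)=\omega_{-i+p}\cdots\omega_{-i+p+r-1}$. The words $\sigma_i(a),\sigma_i(b)$ become $\sigma_{\rm st}(a),\sigma_{\rm st}(b)$ after $i$ cyclic left rotations of each. 3. $\sigma_i$ preserves the intersection tilings: a tiling of the line through $h\in J^s$ is sent to a tiling of the line through the image of $h$ in $J^s$ under the toral map (with the origin at $(0,t_i)$), the image of $\omega_0$ starting at place $0$. In particular $\sigma_i$ sends a principal tiling to a principal tiling shifted by $i$ places, with the same lock if $\det F=1$ and the exchanged lock if $\det F=-1$. Moreover every combinatorial substitution preserving a Sturmian word associated with $F$ is realized in this way: $\{\sigma_0,\dots,\sigma_{N-1}\}$ is exactly the set of substitutions $\sigma$ on $\{a,b\}$ such that $\sigma(a)$ has $k$ letters $a$ and $m$ letters $b$, $\sigma(b)$ has $l$ letters $a$ and $n$ letters $b$, and $\sigma(\omega_0)\sigma(\omega_1)\sigma(\omega_2)\cdots=\omega'_0\omega'_1\omega'_2\cdots$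 for some intersection tilings $\omega,\omega'$. -/

import Mathlib

open Set Matrix

noncomputable section

/-- The real parameters of a bi-partition: `s 0, s 1` are the widths and `u 0, u 1` the heights of
its two rectangles. The index `0` stands for the first rectangle (letter `a`) and `1` for the
second one (letter `b`). -/
structure BiPartition where
  s : Fin 2 → ℝ
  u : Fin 2 → ℝ
  s_pos : ∀ i, 0 < s i
  u_pos : ∀ i, 0 < u i

namespace BiPartition

variable (P : BiPartition)

/-- The rectangles `[0, s₁] × [0, u₁]` (index `0`) and `[-s₂, 0] × [0, u₂]` (index `1`). -/
def rect : Fin 2 → Set (ℝ × ℝ) :=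
  ![Icc 0 (P.s 0) ×ˢ Icc 0 (P.u 0), Icc (-P.s 1) 0 ×ˢ Icc 0 (P.u 1)]

/-- The open horizontal bases `(0, s₁)` and `(-s₂, 0)` of the two rectangles. -/
def base : Fin 2 → Set ℝ :=
  ![Ioo 0 (P.s 0), Ioo (-P.s 1) 0]

/-- The horizontal spine `[-s₂, s₁]` of the horizontal axis. -/
def hSpine : Set (ℝ × ℝ) := Icc (-P.s 1) (P.s 0) ×ˢ {0}

/-- The vertical spine `[0, u₁ + u₂]` of the vertical axis. -/
def vSpine : Set (ℝ × ℝ) := {0} ×ˢ Icc 0 (P.u 0 + P.u 1)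

theorem area_pos : 0 < P.s 0 * P.u 0 + P.s 1 * P.u 1 :=
  add_pos (mul_pos (P.s_pos 0) (P.u_pos 0)) (mul_pos (P.s_pos 1) (P.u_pos 1))

/-- The coordinates `(ξ, η)` of the plane, with `x = s₂ ξ - s₁ η` and `y = u₁ ξ + u₂ η`. -/
def coords : (ℝ × ℝ) ≃ₗ[ℝ] (Fin 2 → ℝ) where
  toFun q := ![(P.u 1 * q.1 + P.s 0 * q.2) / (P.s 0 * P.u 0 + P.s 1 * P.u 1),
    (P.s 1 * q.2 - P.u 0 * q.1) / (P.s 0 * P.u 0 + P.s 1 * P.u 1)]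
  invFun c := (P.s 1 * c 0 - P.s 0 * c 1, P.u 0 * c 0 + P.u 1 * c 1)
  map_add' q q' := by
    ext i; fin_cases i <;> simp <;> ring
  map_smul' c q := by
    ext i; fin_cases i <;> simp <;> ring
  left_inv q := by
    have h := P.area_pos.ne'
    ext
    · simp only [Matrix.cons_val_zero, Matrix.cons_val_one]
      rw [mul_div_assoc', mul_div_assoc', ← sub_div, div_eq_iff h]
      ring
    · simp only [Matrix.cons_val_zero, Matrix.cons_val_one]
      rw [mul_div_assoc', mul_div_assoc', ← add_div, div_eq_iff h]
      ring
  right_inv c := by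
    have h := P.area_pos.ne'
    ext i
    fin_cases i
    · simp only [Fin.zero_eta, Matrix.cons_val_zero]
      rw [div_eq_iff h]
      ring
    · simp only [Fin.mk_one, Matrix.cons_val_one, Matrix.cons_val_zero]
      rw [div_eq_iff h]
      ring

/-- The basis `e₀ = (s₂, u₁)`, `f₀ = (-s₁, u₂)` of the plane. -/
def basis : Module.Basis (Fin 2) ℝ (ℝ × ℝ) := Module.Basis.ofEquivFun P.coords

theorem basis_zero : P.basis 0 = (P.s 1, P.u 0) := by
  simp [basis, coords]

theorem basis_one : P.basis 1 = (-P.s 0, P.u 1) := by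
  simp [basis, coords]

/-- The lattice generated by `e₀` and `f₀`. -/
def lattice : AddSubgroup (ℝ × ℝ) := AddSubgroup.closure (range P.basis)

/-- The torus. -/
abbrev Torus : Type := (ℝ × ℝ) ⧸ P.lattice

/-- The projection from the plane to the torus. -/
def proj : ℝ × ℝ → P.Torus := fun q => (q : (ℝ × ℝ) ⧸ P.lattice)

/-- The linear map of the plane that is given by the matrix `F` in the basis `e₀, f₀`. -/
def linMap (F : Matrix (Fin 2) (Fin 2) ℕ) : (ℝ × ℝ) →ₗ[ℝ] (ℝ × ℝ) :=
  Matrix.toLin P.basis P.basis (F.map (fun x : ℕ => (x : ℝ)))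

theorem lattice_le_comap (F : Matrix (Fin 2) (Fin 2) ℕ) :
    P.lattice ≤ P.lattice.comap (P.linMap F).toAddMonoidHom := by
  rw [lattice, AddSubgroup.closure_le]
  rintro _ ⟨j, rfl⟩
  have hb : ∀ i, P.basis i ∈ P.lattice := fun i => AddSubgroup.subset_closure ⟨i, rfl⟩
  have h : P.linMap F (P.basis j) = ∑ i, F i j • P.basis i := by
    simp [linMap, Matrix.toLin_self, Matrix.map_apply, -nsmul_eq_mul, Nat.cast_smul_eq_nsmul ℝ]
  change P.linMap F (P.basis j) ∈ P.lattice
  rw [h]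
  exact sum_mem fun i _ => nsmul_mem (hb i) _

/-- The map of the torus that is given by the matrix `F` in the basis `e₀, f₀`. -/
def toralMap (F : Matrix (Fin 2) (Fin 2) ℕ) : P.Torus →+ P.Torus :=
  QuotientAddGroup.map P.lattice P.lattice (P.linMap F).toAddMonoidHom (P.lattice_le_comap F)

/-- The image in the torus of the translate of `S` by the vector `v`. -/
def place (v : ℝ × ℝ) (S : Set (ℝ × ℝ)) : Set P.Torus := P.proj '' ((fun q => v + q) '' S)

/-- The bi-partition translated by `v` is a Berg partition for the toral map given by `F`. -/
def IsBerg (F : Matrix (Fin 2) (Fin 2) ℕ) (v : ℝ × ℝ) : Prop :=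
  P.toralMap F '' P.place v P.hSpine ⊆ P.place v P.hSpine ∧
    P.place v P.vSpine ⊆ P.toralMap F '' P.place v P.vSpine

/-- The bi-partition translated by `v` has the connectivity matrix `C` under the toral map given
by `F`: the image of the interior of the rectangle `i` meets the interior of the rectangle `j`
in exactly `C i j` connected components. -/
def HasConnectivityMatrix (F : Matrix (Fin 2) (Fin 2) ℕ) (v : ℝ × ℝ)
    (C : Matrix (Fin 2) (Fin 2) ℕ) : Prop :=
  ∀ i j, ENat.card (ConnectedComponents
    ↥(P.toralMap F '' P.place v (interior (P.rect i)) ∩ P.place v (interior (P.rect j)))) =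
      (C i j : ℕ∞)

/-- In the periodic tiling of the plane by the lattice translates of the rectangles `v + rect c`,
some translate of the rectangle `c` meets the vertical line through `(x, 0)` in the segment of
height `u c` with the lower endpoint `(x, y)`. -/
def IsTile (v : ℝ × ℝ) (x y : ℝ) (c : Fin 2) : Prop :=
  ∃ z ∈ P.lattice,
    {q : ℝ × ℝ | q.1 = x} ∩ (fun q => v + z + q) '' P.rect c = {x} ×ˢ Icc y (y + P.u c)

/-- The vertical segment `{x} × [y, y']` is cut by the periodic tiling into tiles whose types,
from the bottom to the top, form the word `w`. -/
def CutInto (v : ℝ × ℝ) (x : ℝ) : ℝ → ℝ → List (Fin 2) → Prop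
  | y, y', [] => y = y'
  | y, y', c :: w => P.IsTile v x y c ∧ CutInto v x (y + P.u c) y' w

/-- `ω` is an intersection tiling of the vertical line through the point `(x, 0)` of the horizontal
spine, where `ω 0` is the tile whose lower endpoint is `(x, 0)`. -/
def IsTiling (x : ℝ) (ω : ℤ → Fin 2) : Prop :=
  x ∈ Icc (-P.s 1) (P.s 0) ∧
    ∃ y : ℤ → ℝ, y 0 = 0 ∧ ∀ n, y (n + 1) = y n + P.u (ω n) ∧ P.IsTile 0 x (y n) (ω n)

/-- The set of all intersection tilings. -/
def tilings : Set (ℤ → Fin 2) := {ω | ∃ x, P.IsTiling x ω}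

end BiPartition

/-- A substitution on two letters: letter `j` is replaced by the word `σ j`. -/
abbrev Substitution : Type := Fin 2 → List (Fin 2)

/-- The word `ω m, ω (m + 1), …, ω (m + n - 1)`. -/
def factor (ω : ℤ → Fin 2) (m : ℤ) (n : ℕ) : List (Fin 2) :=
  (List.range n).map fun i => ω (m + i)

namespace Substitution

/-- `σ` has the matrix `F`: the word `σ j` has `F i j` letters `i`. -/
def HasMatrix (σ : Substitution) (F : Matrix (Fin 2) (Fin 2) ℕ) : Prop :=
  ∀ i j, (σ j).count i = F i j

/-- `ω'` is the concatenation `… σ(ω₋₁) σ(ω₀) σ(ω₁) …`, where the word `σ(ω₀)` starts at the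
place `0`. -/
def IsImage (σ : Substitution) (ω ω' : ℤ → Fin 2) : Prop :=
  ∃ N : ℤ → ℤ, N 0 = 0 ∧ ∀ n, N (n + 1) = N n + (σ (ω n)).length ∧
    factor ω' (N n) (σ (ω n)).length = σ (ω n)

/-- The right half `ω'₀ ω'₁ …` is the concatenation `σ(ω₀) σ(ω₁) …`. -/
def IsRightImage (σ : Substitution) (ω ω' : ℤ → Fin 2) : Prop :=
  ∃ N : ℤ → ℤ, N 0 = 0 ∧ ∀ n, 0 ≤ n → N (n + 1) = N n + (σ (ω n)).length ∧
    factor ω' (N n) (σ (ω n)).length = σ (ω n)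

end Substitution

namespace BiPartition

variable (P : BiPartition)

/-- The toral map given by `F` acts on the bi-partition translated by `v` by the substitution `σ`:
the image of every vertical segment that runs through the rectangle `j` from its bottom to its top
side, away from its vertical sides, is cut by the partition into the word `σ j`. -/
def Realizes (F : Matrix (Fin 2) (Fin 2) ℕ) (v : ℝ × ℝ) (σ : Substitution) : Prop :=
  ∀ j, ∀ x ∈ P.base j, ∃ x' y y' : ℝ,
    P.linMap F '' ((fun q => v + q) '' ({x} ×ˢ Icc 0 (P.u j))) = {x'} ×ˢ Icc y y' ∧
      P.CutInto v x' y y' (σ j)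

/-- The standard substitution of `F = [k, l; m, n]`. Let `ωₐ` and `ω_b` be the two principal
tilings, with the lock `[a, b]` and `[b, a]` at the places `0, 1`. If `det F = 1`, then `a` goes
to the first `k + m` letters of `ωₐ` and `b` to the first `l + n` letters of `ω_b`, both from the
place `0` on; if `det F = -1`, then `ωₐ` and `ω_b` are exchanged. -/
def IsStandard (F : Matrix (Fin 2) (Fin 2) ℕ) (σ : Substitution) : Prop :=
  ∃ ωa ωb : ℤ → Fin 2, P.IsTiling 0 ωa ∧ ωa 0 = 0 ∧ ωa 1 = 1 ∧
    P.IsTiling 0 ωb ∧ ωb 0 = 1 ∧ ωb 1 = 0 ∧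
    ((F.map (fun x : ℕ => (x : ℤ))).det = 1 →
      σ 0 = factor ωa 0 (F 0 0 + F 1 0) ∧ σ 1 = factor ωb 0 (F 0 1 + F 1 1)) ∧
    ((F.map (fun x : ℕ => (x : ℤ))).det = -1 →
      σ 0 = factor ωb 0 (F 0 0 + F 1 0) ∧ σ 1 = factor ωa 0 (F 0 1 + F 1 1))

end BiPartition

/-- No eigenvalue of `F` has absolute value one. -/
def IsHyperbolicMatrix (F : Matrix (Fin 2) (Fin 2) ℕ) : Prop :=
  ∀ z ∈ spectrum ℂ (F.map (fun x : ℕ => (x : ℂ))), ‖z‖ ≠ 1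

end

/-!
In the coordinates of the eigendirections the map `F` is diagonal: it multiplies abscissas by `mu`
and ordinates by `lam`, where `lam > 1` and `lam * mu = det F = ±1` (`IsEigen`). Lattice points are
kept in their integer coordinates `z`, with the abscissa `latX z` and the ordinate `latY z`. Both
functions are injective, since the eigendirections are irrational.

**Tilings.** A tiling of the line through `(y, 0)` is an orbit of an exchange of two intervals: the
`n`-th tile has its corner at the only lattice point `z` with `latLen z = n` and `y - latX z` in the
spine. If the line meets a lattice point, this point of the spine is ambiguous, and the line can be
read on either side; `word ε y` is the reading on the side `ε`, where the intervals are half-open.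
These are all tilings (`IsTiling.exists_word`).

**Berg partitions.** The translate by `(0, -τ)` is a Berg partition if and only if
`(lam - 1) τ = latY w` for a lattice point `w` such that `x ↦ mu x + latX w`, the action of the toral
map on the horizontal spine, maps the spine into itself (`isBerg_iff`). For this it suffices that
`w` lies above the spine at a height in `[0, (lam - 1)(u₁ + u₂)]`: if the image stuck out, then the
preimage of `w + e₀` or of `w + f₀` would be a lattice point in the interior of the fundamental
domain (`admissible_of_mem`, `no_latVec_between`). The lattice points above the spine are the
corners of the principal tilings, and the highest one of them at these heights is
`F (e₀ + f₀) - (e₀ + f₀)`; this gives the number of Berg partitions (`admissible_neg_corner_iff`).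

**Substitutions.** The image of a vertical segment through the interior of a rectangle contains no
lattice point, since the preimage of this point would be a lattice point in the interior of a
column (`no_crossing`). So the image of the segment is cut into the same word wherever the segment
is (`factor_word_image`), which defines `subst`. Moving the segment to the left side of its
rectangle shows that the two words are adjacent windows of a principal tiling; applying the same to
all tiles of a line shows that tilings go to tilings. For `w ≠ 0` the image of the spine does not
cross the vertical spine, so that all words begin with the same letter, which is the reason for the
rotations (`principal_periodic`). Each letter `j` of the word of `i` is a strip in the intersection
of the image of the rectangle `i` with the rectangle `j`, which gives the connectivity matrix.

**The converse.** If `σ` has the matrix `F` and maps a tiling to a tiling, then the orbit of the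
first line goes to the orbit of the second one by an affine map with the slope `mu`. By density of
the orbits it maps the spine into itself, and the intervals of the spine that belong to the letters
of `σ a` and `σ b` cover the spine. No interval contains `0` in its interior, so that `0` is an end
of an interval; hence the affine map belongs to a lattice point, and this point is admissible
(`exists_eq_subst`).
-/

/-! ### Lattice points and the action of the matrix -/

/-- The action of the matrix on the integer coordinates `(A, B)` of the lattice point
`A e₀ + B f₀`. -/
def latAct (F : Matrix (Fin 2) (Fin 2) ℕ) (z : ℤ × ℤ) : ℤ × ℤ :=
  (F 0 0 * z.1 + F 0 1 * z.2, F 1 0 * z.1 + F 1 1 * z.2)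

/-- The number of tiles between the origin and a lattice point, counted with sign. -/
def latLen (z : ℤ × ℤ) : ℤ := z.1 + z.2

/-- The integer coordinates of the lattice vector from the corner of a tile of type `c` to the corner
of the next tile on a vertical line: `e₀` for the letter `a` and `f₀` for the letter `b`. -/
def latVec (c : Fin 2) : ℤ × ℤ := ![(1, 0), (0, 1)] c

@[simp] theorem latVec_zero : latVec 0 = (1, 0) := rfl

@[simp] theorem latVec_one : latVec 1 = (0, 1) := rfl

theorem latLen_add (z z' : ℤ × ℤ) : latLen (z + z') = latLen z + latLen z' := by
  simp only [latLen, Prod.fst_add, Prod.snd_add]; ring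

theorem latLen_sub (z z' : ℤ × ℤ) : latLen (z - z') = latLen z - latLen z' := by
  simp only [latLen, Prod.fst_sub, Prod.snd_sub]; ring

theorem latLen_neg (z : ℤ × ℤ) : latLen (-z) = -latLen z := by
  simp only [latLen, Prod.fst_neg, Prod.snd_neg]; ring

@[simp] theorem latLen_zero : latLen 0 = 0 := rfl

@[simp] theorem latLen_latVec (c : Fin 2) : latLen (latVec c) = 1 := by
  fin_cases c <;> rfl

theorem latAct_add (F : Matrix (Fin 2) (Fin 2) ℕ) (z z' : ℤ × ℤ) :
    latAct F (z + z') = latAct F z + latAct F z' := by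
  ext <;> simp only [latAct, Prod.fst_add, Prod.snd_add] <;> ring

@[simp] theorem latAct_zero (F : Matrix (Fin 2) (Fin 2) ℕ) : latAct F 0 = 0 := by
  ext <;> simp [latAct]

theorem latAct_latVec (F : Matrix (Fin 2) (Fin 2) ℕ) (c : Fin 2) :
    latAct F (latVec c) = ((F 0 c : ℤ), (F 1 c : ℤ)) := by
  fin_cases c <;> simp [latAct]

theorem latLen_latAct_latVec (F : Matrix (Fin 2) (Fin 2) ℕ) (c : Fin 2) :
    latLen (latAct F (latVec c)) = (F 0 c + F 1 c : ℕ) := by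
  rw [latAct_latVec]; simp [latLen]

namespace BiPartition

variable (P : BiPartition)

/-- The abscissa of the lattice point `A e₀ + B f₀`. -/
def latX (z : ℤ × ℤ) : ℝ := P.s 1 * z.1 - P.s 0 * z.2

/-- The ordinate of the lattice point `A e₀ + B f₀`. -/
def latY (z : ℤ × ℤ) : ℝ := P.u 0 * z.1 + P.u 1 * z.2

theorem latX_add (z z' : ℤ × ℤ) : P.latX (z + z') = P.latX z + P.latX z' := by
  simp only [latX, Prod.fst_add, Prod.snd_add]; push_cast; ring

theorem latX_sub (z z' : ℤ × ℤ) : P.latX (z - z') = P.latX z - P.latX z' := by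
  simp only [latX, Prod.fst_sub, Prod.snd_sub]; push_cast; ring

theorem latX_neg (z : ℤ × ℤ) : P.latX (-z) = -P.latX z := by
  simp only [latX, Prod.fst_neg, Prod.snd_neg]; push_cast; ring

@[simp] theorem latX_zero : P.latX 0 = 0 := by simp [latX]

theorem latY_add (z z' : ℤ × ℤ) : P.latY (z + z') = P.latY z + P.latY z' := by
  simp only [latY, Prod.fst_add, Prod.snd_add]; push_cast; ring

theorem latY_sub (z z' : ℤ × ℤ) : P.latY (z - z') = P.latY z - P.latY z' := by
  simp only [latY, Prod.fst_sub, Prod.snd_sub]; push_cast; ring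

theorem latY_neg (z : ℤ × ℤ) : P.latY (-z) = -P.latY z := by
  simp only [latY, Prod.fst_neg, Prod.snd_neg]; push_cast; ring

@[simp] theorem latY_zero : P.latY 0 = 0 := by simp [latY]

theorem latX_latVec_zero : P.latX (latVec 0) = P.s 1 := by simp [latX]

theorem latX_latVec_one : P.latX (latVec 1) = -P.s 0 := by simp [latX]

theorem latY_latVec (c : Fin 2) : P.latY (latVec c) = P.u c := by
  fin_cases c <;> simp [latY]

theorem mem_lattice_iff {q : ℝ × ℝ} :
    q ∈ P.lattice ↔ ∃ z : ℤ × ℤ, q = (P.latX z, P.latY z) := by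
  have hr : range P.basis = {(P.s 1, P.u 0), (-P.s 0, P.u 1)} := by
    rw [← P.basis_zero, ← P.basis_one]
    ext q
    simp only [mem_range, Fin.exists_fin_two, mem_insert_iff, mem_singleton_iff, eq_comm]
  rw [lattice, hr, AddSubgroup.mem_closure_pair]
  constructor
  · rintro ⟨A, B, rfl⟩
    exact ⟨(A, B), by ext <;> simp [latX, latY] <;> ring⟩
  · rintro ⟨⟨A, B⟩, rfl⟩
    exact ⟨A, B, by ext <;> simp [latX, latY] <;> ring⟩

theorem proj_eq_iff {q q' : ℝ × ℝ} :
    P.proj q = P.proj q' ↔ ∃ z : ℤ × ℤ, q' = q + (P.latX z, P.latY z) := by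
  rw [proj, proj, QuotientAddGroup.eq, mem_lattice_iff]
  refine exists_congr fun z => ?_
  rw [neg_add_eq_iff_eq_add]

/-- No lattice vector has an abscissa in `(-s₁, s₂)` and an ordinate strictly between `0` and
`u₁ + u₂`: in this range the vertical spine and its translates are disjoint. -/
theorem no_latVec_between {v : ℤ × ℤ} (h1 : -P.s 0 < P.latX v) (h2 : P.latX v < P.s 1)
    (h3 : 0 < P.latY v) (h4 : P.latY v < P.u 0 + P.u 1) : False := by
  obtain ⟨A, B⟩ := v
  simp only [latX, latY] at *
  have s0 := P.s_pos 0; have s1 := P.s_pos 1; have u0 := P.u_pos 0; have u1 := P.u_pos 1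
  rcases le_or_gt A 0 with hA | hA
  · have hA' : (A : ℝ) ≤ 0 := by exact_mod_cast hA
    rcases le_or_gt B 0 with hB | hB
    · have hB' : (B : ℝ) ≤ 0 := by exact_mod_cast hB
      nlinarith
    · have hB' : (1 : ℝ) ≤ B := by exact_mod_cast hB
      nlinarith
  · have hA' : (1 : ℝ) ≤ A := by exact_mod_cast hA
    rcases le_or_gt B 0 with hB | hB
    · have hB' : (B : ℝ) ≤ 0 := by exact_mod_cast hB
      nlinarith
    · have hB' : (1 : ℝ) ≤ B := by exact_mod_cast hB
      nlinarith

/-- No lattice vector lies above the base of the rectangle `c`, higher than `-(u₁ + u₂)` and lower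
than the top of the rectangle. -/
theorem no_latVec_in_column {v : ℤ × ℤ} {c : Fin 2} (h : P.latX v ∈ P.base c)
    (h3 : -(P.u 0 + P.u 1) < P.latY v) (h4 : P.latY v < P.u c) : False := by
  obtain ⟨A, B⟩ := v
  have s0 := P.s_pos 0; have s1 := P.s_pos 1; have u0 := P.u_pos 0; have u1 := P.u_pos 1
  have key : ∀ n : ℤ, (n : ℝ) ≤ -1 ∨ (n : ℝ) = 0 ∨ 1 ≤ (n : ℝ) := by
    intro n
    rcases lt_trichotomy n 0 with h | h | h
    · left; exact_mod_cast (by omega : n ≤ -1)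
    · right; left; exact_mod_cast h
    · right; right; exact_mod_cast (by omega : 1 ≤ n)
  have hA := key A
  have hB := key B
  fin_cases c <;> simp [latX, latY, base] at h h3 h4 <;> obtain ⟨h1, h2⟩ := h <;>
    rcases hA with hA | hA | hA <;> rcases hB with hB | hB | hB <;> nlinarith

end BiPartition

namespace BiPartition

variable (P : BiPartition)

/-! ### The eigenvalues of the matrix -/

/-- The data of a hyperbolic automorphism preserving the axes: `lam > 1` is the eigenvalue of the
positive eigenvectors `s` and `u`, and `mu` is the other eigenvalue of `F`. -/
structure IsEigen (F : Matrix (Fin 2) (Fin 2) ℕ) (lam mu : ℝ) : Prop where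
  one_lt : 1 < lam
  s_zero : F 0 0 * P.s 0 + F 0 1 * P.s 1 = lam * P.s 0
  s_one : F 1 0 * P.s 0 + F 1 1 * P.s 1 = lam * P.s 1
  u_zero : P.u 0 * F 0 0 + P.u 1 * F 1 0 = lam * P.u 0
  u_one : P.u 0 * F 0 1 + P.u 1 * F 1 1 = lam * P.u 1
  mul_eq : lam * mu = ((F 0 0 * F 1 1 - F 0 1 * F 1 0 : ℤ) : ℝ)
  det_eq : (F 0 0 * F 1 1 - F 0 1 * F 1 0 : ℤ) = 1 ∨ (F 0 0 * F 1 1 - F 0 1 * F 1 0 : ℤ) = -1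

theorem det_map_int (F : Matrix (Fin 2) (Fin 2) ℕ) :
    (F.map (fun x : ℕ => (x : ℤ))).det = F 0 0 * F 1 1 - F 0 1 * F 1 0 := by
  rw [Matrix.det_fin_two]; simp

theorem exists_isEigen (F : Matrix (Fin 2) (Fin 2) ℕ)
    (hdet : IsUnit (F.map (fun x : ℕ => (x : ℤ))).det)
    (hhyp : IsHyperbolicMatrix F)
    (hs : ∃ c : ℝ, (F.map (fun x : ℕ => (x : ℝ))) *ᵥ P.s = c • P.s)
    (hu : ∃ c : ℝ, P.u ᵥ* (F.map (fun x : ℕ => (x : ℝ))) = c • P.u) :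
    ∃ lam mu : ℝ, P.IsEigen F lam mu := by
  obtain ⟨lam, hs⟩ := hs
  obtain ⟨c', hu⟩ := hu
  have s0 := P.s_pos 0; have s1 := P.s_pos 1; have u0 := P.u_pos 0; have u1 := P.u_pos 1
  rw [det_map_int, Int.isUnit_iff] at hdet
  have es0 := congrFun hs 0
  have es1 := congrFun hs 1
  have eu0 := congrFun hu 0
  have eu1 := congrFun hu 1
  simp only [mulVec, vecMul, dotProduct, Fin.sum_univ_two, map_apply, Pi.smul_apply,
    smul_eq_mul] at es0 es1 eu0 eu1
  -- both eigenvectors are positive, so that they belong to the same eigenvalue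
  have hc : c' = lam := by
    have h : (c' - lam) * (P.s 0 * P.u 0 + P.s 1 * P.u 1) = 0 := by
      linear_combination -(P.s 0) * eu0 - P.s 1 * eu1 + P.u 0 * es0 + P.u 1 * es1
    have := (mul_eq_zero.1 h).resolve_right P.area_pos.ne'
    linarith
  subst hc
  have hne : c' ≠ 1 := by
    rintro rfl
    refine hhyp 1 ?_ (by simp)
    rw [spectrum.mem_iff, Matrix.isUnit_iff_isUnit_det, isUnit_iff_ne_zero, not_not,
      Matrix.det_fin_two]
    simp only [map_one, Matrix.sub_apply, one_apply, map_apply]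
    have h : ((1 : ℝ) - F 0 0) * (1 - F 1 1) - F 0 1 * F 1 0 = 0 := by
      have : P.s 0 * P.s 1 * (((1 : ℝ) - F 0 0) * (1 - F 1 1) - F 0 1 * F 1 0) = 0 := by
        linear_combination (-(1 - F 1 1) * P.s 1) * es0 - (F 0 1 * P.s 1) * es1
      exact (mul_eq_zero.1 this).resolve_left (mul_pos s0 s1).ne'
    have h' : ((((1 : ℝ) - F 0 0) * (1 - F 1 1) - F 0 1 * F 1 0 : ℝ) : ℂ) = 0 := by
      rw [h]; simp
    push_cast at h'
    simpa using h'
  have hpos : ∀ i j, (0 : ℝ) ≤ F i j := fun i j => Nat.cast_nonneg _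
  have h1 : 1 < c' := by
    by_contra hcon
    have hlt : c' < 1 := lt_of_le_of_ne (not_lt.1 hcon) hne
    have h00 : F 0 0 = 0 := by
      by_contra h
      have : (1 : ℝ) ≤ F 0 0 := by exact_mod_cast Nat.one_le_iff_ne_zero.2 h
      nlinarith [mul_nonneg (hpos 0 1) s1.le]
    have h11 : F 1 1 = 0 := by
      by_contra h
      have : (1 : ℝ) ≤ F 1 1 := by exact_mod_cast Nat.one_le_iff_ne_zero.2 h
      nlinarith [mul_nonneg (hpos 1 0) s0.le]
    have hlm : F 0 1 * F 1 0 = 1 := by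
      rw [h00, h11] at hdet
      have h2 : (0 : ℤ) ≤ (F 0 1 : ℤ) * F 1 0 := by positivity
      have : ((F 0 1 * F 1 0 : ℕ) : ℤ) = 1 := by push_cast at hdet ⊢; omega
      exact_mod_cast this
    rw [h00, Nat.eq_one_of_mul_eq_one_right hlm] at es0
    rw [h11, Nat.eq_one_of_mul_eq_one_left hlm] at es1
    norm_num at es0 es1
    nlinarith
  refine ⟨c', ((F 0 0 * F 1 1 - F 0 1 * F 1 0 : ℤ) : ℝ) / c', h1, es0, es1, eu0, eu1, ?_, hdet⟩
  field_simp

namespace IsEigen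

variable {P} {F : Matrix (Fin 2) (Fin 2) ℕ} {lam mu : ℝ} (E : P.IsEigen F lam mu)
include E

theorem lam_pos : 0 < lam := one_pos.trans E.one_lt

theorem mul_cases : lam * mu = 1 ∨ lam * mu = -1 := by
  rw [E.mul_eq]
  rcases E.det_eq with h | h <;> rw [h] <;> simp

theorem mu_ne_zero : mu ≠ 0 := by
  rintro rfl
  rcases E.mul_cases with h | h <;> simp at h

theorem abs_mu_lt_one : |mu| < 1 := by
  have h : lam * |mu| = 1 := by
    rw [← abs_of_pos E.lam_pos, ← abs_mul]
    rcases E.mul_cases with h | h <;> simp [h]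
  have := E.one_lt
  have := abs_nonneg mu
  nlinarith

theorem det_eq_one_iff : (F.map (fun x : ℕ => (x : ℤ))).det = 1 ↔ 0 < mu := by
  have h0 := E.lam_pos
  have h := E.mul_eq
  rw [det_map_int]
  rcases E.det_eq with h' | h' <;> rw [h'] at h ⊢ <;> norm_num at h ⊢ <;> nlinarith

theorem det_eq_neg_one_iff : (F.map (fun x : ℕ => (x : ℤ))).det = -1 ↔ mu < 0 := by
  have h0 := E.lam_pos
  have h := E.mul_eq
  rw [det_map_int]
  rcases E.det_eq with h' | h' <;> rw [h'] at h ⊢ <;> norm_num at h ⊢ <;> nlinarith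

theorem mul_s_one : mu * P.s 1 = P.s 1 * F 0 0 - P.s 0 * F 1 0 := by
  apply mul_left_cancel₀ E.lam_pos.ne'
  have h := E.mul_eq
  push_cast at h
  linear_combination P.s 1 * h + F 0 0 * E.s_one - F 1 0 * E.s_zero

theorem mul_s_zero : mu * P.s 0 = P.s 0 * F 1 1 - P.s 1 * F 0 1 := by
  apply mul_left_cancel₀ E.lam_pos.ne'
  have h := E.mul_eq
  push_cast at h
  linear_combination P.s 0 * h + F 1 1 * E.s_zero - F 0 1 * E.s_one

theorem latX_act (z : ℤ × ℤ) : P.latX (latAct F z) = mu * P.latX z := by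
  simp only [latX, latAct]
  push_cast
  linear_combination -(z.1 : ℝ) * E.mul_s_one + (z.2 : ℝ) * E.mul_s_zero

theorem latY_act (z : ℤ × ℤ) : P.latY (latAct F z) = lam * P.latY z := by
  simp only [latY, latAct]
  push_cast
  linear_combination (z.1 : ℝ) * E.u_zero + (z.2 : ℝ) * E.u_one

theorem exists_latAct_eq (z : ℤ × ℤ) : ∃ z', latAct F z' = z := by
  refine ⟨((F 0 0 * F 1 1 - F 0 1 * F 1 0 : ℤ) * (F 1 1 * z.1 - F 0 1 * z.2),
    (F 0 0 * F 1 1 - F 0 1 * F 1 0 : ℤ) * (F 0 0 * z.2 - F 1 0 * z.1)), ?_⟩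
  have hd : (F 0 0 * F 1 1 - F 0 1 * F 1 0 : ℤ) * (F 0 0 * F 1 1 - F 0 1 * F 1 0 : ℤ) = 1 := by
    rcases E.det_eq with h | h <;> rw [h] <;> norm_num
  ext
  · simp only [latAct]; linear_combination z.1 * hd
  · simp only [latAct]; linear_combination z.2 * hd

/-- The slope of the contracted direction is irrational: on a rational line of the eigendirection
the inverse automorphism would contract the lattice points. -/
theorem latX_eq_zero {z : ℤ × ℤ} (h : P.latX z = 0) : z = 0 := by
  have s0 := P.s_pos 0; have s1 := P.s_pos 1
  suffices ∀ (n : ℕ) (z : ℤ × ℤ), z.1.natAbs = n → P.latX z = 0 → z = 0 from this _ z rfl h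
  intro n
  induction n using Nat.strong_induction_on with
  | _ n ih =>
    intro z hz h
    obtain ⟨z', rfl⟩ := E.exists_latAct_eq z
    rw [E.latX_act] at h
    have h' := (mul_eq_zero.1 h).resolve_left E.mu_ne_zero
    have e : ((latAct F z').1 : ℝ) = lam * z'.1 := by
      apply mul_left_cancel₀ s0.ne'
      simp only [latX] at h'
      simp only [latAct]
      push_cast
      linear_combination (z'.1 : ℝ) * E.s_zero - F 0 1 * h'
    by_cases h0 : z'.1 = 0
    · have : z' = 0 := by
        ext
        · exact h0
        · simp only [latX, h0] at h'
          norm_num at h'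
          simpa [s0.ne'] using h'
      rw [this, latAct_zero]
    · have hlt : z'.1.natAbs < n := by
        have : ((z'.1.natAbs : ℤ) : ℝ) < ((n : ℤ) : ℝ) := by
          rw [← hz, Int.natCast_natAbs, Int.natCast_natAbs, Int.cast_abs, Int.cast_abs, e,
            abs_mul, abs_of_pos E.lam_pos]
          have : 0 < |(z'.1 : ℝ)| := abs_pos.2 (by exact_mod_cast h0)
          have := E.one_lt
          nlinarith
        exact_mod_cast this
      rw [ih _ hlt z' rfl h', latAct_zero]

/-- The slope of the expanded direction is irrational. -/
theorem latY_eq_zero {z : ℤ × ℤ} (h : P.latY z = 0) : z = 0 := by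
  have u0 := P.u_pos 0; have u1 := P.u_pos 1
  suffices ∀ (n : ℕ) (z : ℤ × ℤ), z.1.natAbs = n → P.latY z = 0 → z = 0 from this _ z rfl h
  intro n
  induction n using Nat.strong_induction_on with
  | _ n ih =>
    intro z hz h
    have hy : P.latY (latAct F z) = 0 := by rw [E.latY_act, h, mul_zero]
    have e : ((latAct F z).1 : ℝ) = mu * z.1 := by
      have h2 : (P.s 0 * P.u 0 + P.s 1 * P.u 1) * ((latAct F z).1 : ℝ)
          = P.u 1 * P.latX (latAct F z) + P.s 0 * P.latY (latAct F z) := by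
        simp only [latX, latY]; ring
      have h3 : (P.s 0 * P.u 0 + P.s 1 * P.u 1) * (z.1 : ℝ)
          = P.u 1 * P.latX z + P.s 0 * P.latY z := by
        simp only [latX, latY]; ring
      apply mul_left_cancel₀ P.area_pos.ne'
      rw [h2, hy, E.latX_act]
      rw [h] at h3
      linear_combination -mu * h3
    by_cases h0 : z.1 = 0
    · ext
      · exact h0
      · simp only [latY, h0] at h
        norm_num at h
        simpa [u1.ne'] using h
    · have hlt : (latAct F z).1.natAbs < n := by
        have : (((latAct F z).1.natAbs : ℤ) : ℝ) < ((n : ℤ) : ℝ) := by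
          rw [← hz, Int.natCast_natAbs, Int.natCast_natAbs, Int.cast_abs, Int.cast_abs, e,
            abs_mul]
          have : 0 < |(z.1 : ℝ)| := abs_pos.2 (by exact_mod_cast h0)
          have := E.abs_mu_lt_one
          nlinarith
        exact_mod_cast this
      have h1 := ih _ hlt _ rfl hy
      rw [h1] at e
      simp only [Prod.fst_zero, Int.cast_zero, zero_eq_mul, E.mu_ne_zero, false_or] at e
      exact absurd (by exact_mod_cast e) h0

theorem latX_injective : Function.Injective P.latX := fun z z' h =>
  sub_eq_zero.1 (E.latX_eq_zero (by rw [P.latX_sub, h, sub_self]))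

theorem latY_injective : Function.Injective P.latY := fun z z' h =>
  sub_eq_zero.1 (E.latY_eq_zero (by rw [P.latY_sub, h, sub_self]))

theorem linMap_apply (q : ℝ × ℝ) : P.linMap F q = (mu * q.1, lam * q.2) := by
  let D : (ℝ × ℝ) →ₗ[ℝ] (ℝ × ℝ) :=
    (LinearMap.lsmul ℝ ℝ mu).prodMap (LinearMap.lsmul ℝ ℝ lam)
  have h : P.linMap F = D := by
    refine P.basis.ext fun j => ?_
    rw [linMap, Matrix.toLin_self, Fin.sum_univ_two, P.basis_zero, P.basis_one]
    fin_cases j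
    · rw [Fin.zero_eta, P.basis_zero]
      ext
      · simp only [D, map_apply, Prod.fst_add, Prod.smul_fst, smul_eq_mul, LinearMap.prodMap_apply,
          LinearMap.lsmul_apply]
        linear_combination -E.mul_s_one
      · simp only [D, map_apply, Prod.snd_add, Prod.smul_snd, smul_eq_mul, LinearMap.prodMap_apply,
          LinearMap.lsmul_apply]
        linear_combination E.u_zero
    · rw [Fin.mk_one, P.basis_one]
      ext
      · simp only [D, map_apply, Prod.fst_add, Prod.smul_fst, smul_eq_mul, LinearMap.prodMap_apply,
          LinearMap.lsmul_apply]
        linear_combination E.mul_s_zero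
      · simp only [D, map_apply, Prod.snd_add, Prod.smul_snd, smul_eq_mul, LinearMap.prodMap_apply,
          LinearMap.lsmul_apply]
        linear_combination E.u_one
  rw [h]; rfl

theorem toralMap_proj (q : ℝ × ℝ) :
    P.toralMap F (P.proj q) = P.proj (mu * q.1, lam * q.2) := by
  rw [← E.linMap_apply]; rfl

theorem column_pos (c : Fin 2) : 0 < F 0 c + F 1 c := by
  by_contra h
  have h0 : F 0 c = 0 := by omega
  have h1 : F 1 c = 0 := by omega
  have := E.det_eq
  fin_cases c <;> simp_all

theorem row_pos (c : Fin 2) : 0 < F c 0 + F c 1 := by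
  by_contra h
  have h0 : F c 0 = 0 := by omega
  have h1 : F c 1 = 0 := by omega
  have := E.det_eq
  fin_cases c <;> simp_all

theorem le_of_mu_neg (h : mu < 0) : P.s 0 ≤ lam * P.s 1 ∧ P.s 1 ≤ lam * P.s 0 := by
  have hd := E.det_eq_neg_one_iff.2 h
  rw [det_map_int] at hd
  have s0 := P.s_pos 0; have s1 := P.s_pos 1
  have hpos : ∀ i j, (0 : ℝ) ≤ F i j := fun i j => Nat.cast_nonneg _
  have key : 1 ≤ F 0 1 * F 1 0 := by
    have : (0 : ℤ) ≤ (F 0 0 : ℤ) * F 1 1 := by positivity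
    have : (1 : ℤ) ≤ ((F 0 1 * F 1 0 : ℕ) : ℤ) := by push_cast; omega
    exact_mod_cast this
  have h01 : (1 : ℝ) ≤ F 0 1 := by
    exact_mod_cast Nat.one_le_iff_ne_zero.2 (by rintro h; simp [h] at key)
  have h10 : (1 : ℝ) ≤ F 1 0 := by
    exact_mod_cast Nat.one_le_iff_ne_zero.2 (by rintro h; simp [h] at key)
  constructor
  · rw [← E.s_one]; nlinarith [mul_nonneg (hpos 1 1) s1.le]
  · rw [← E.s_zero]; nlinarith [mul_nonneg (hpos 0 0) s0.le]

end IsEigen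

end BiPartition

/-! ### Factors of bi-infinite words -/

theorem fin_two_eq_zero_or_one (c : Fin 2) : c = 0 ∨ c = 1 := by
  fin_cases c <;> simp

theorem factor_eq_map (ω : ℤ → Fin 2) (m : ℤ) (n : ℕ) :
    factor ω m n = (List.range n).map fun i : ℕ => ω (m + i) := by
  simp only [factor, bind_pure_comp, List.map_eq_map, List.map_map]
  rfl

@[simp] theorem factor_zero (ω : ℤ → Fin 2) (m : ℤ) : factor ω m 0 = [] := rfl

@[simp] theorem length_factor (ω : ℤ → Fin 2) (m : ℤ) (n : ℕ) : (factor ω m n).length = n := by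
  simp [factor_eq_map]

theorem factor_succ (ω : ℤ → Fin 2) (m : ℤ) (n : ℕ) :
    factor ω m (n + 1) = ω m :: factor ω (m + 1) n := by
  simp only [factor_eq_map, List.range_succ_eq_map, List.map_cons, List.map_map, Nat.cast_zero,
    add_zero]
  congr 1
  refine List.map_congr_left fun i _ => ?_
  simp only [Function.comp, Nat.cast_succ]
  congr 1; ring

theorem factor_succ_last (ω : ℤ → Fin 2) (m : ℤ) (n : ℕ) :
    factor ω m (n + 1) = factor ω m n ++ [ω (m + n)] := by
  simp [factor_eq_map, List.range_succ]

theorem factor_congr {ω ω' : ℤ → Fin 2} {m m' : ℤ} {n : ℕ}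
    (h : ∀ k : ℕ, k < n → ω (m + k) = ω' (m' + k)) : factor ω m n = factor ω' m' n := by
  rw [factor_eq_map, factor_eq_map]
  exact List.map_congr_left fun k hk => h k (List.mem_range.1 hk)

theorem getElem_factor (ω : ℤ → Fin 2) (m : ℤ) (n k : ℕ) (hk : k < (factor ω m n).length) :
    (factor ω m n)[k] = ω (m + k) := by
  simp [factor_eq_map]

theorem eq_of_factor_eq {ω ω' : ℤ → Fin 2} {m m' : ℤ} {n : ℕ}
    (h : factor ω m n = factor ω' m' n) {k : ℕ} (hk : k < n) : ω (m + k) = ω' (m' + k) := by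
  rw [← getElem_factor ω m n k (by simpa using hk), ← getElem_factor ω' m' n k (by simpa using hk)]
  simp only [h]

theorem factor_shift (ω : ℤ → Fin 2) (d m : ℤ) (n : ℕ) :
    factor (fun i => ω (i + d)) m n = factor ω (m + d) n :=
  factor_congr fun k _ => by congr 1; ring

theorem take_factor (ω : ℤ → Fin 2) (m : ℤ) {k n : ℕ} (h : k ≤ n) :
    (factor ω m n).take k = factor ω m k := by
  simp [factor_eq_map, ← List.map_take, List.take_range, h]

/-- Shifting a window to the left rotates the word that is seen through it, as long as the letters
that leave on the right come back on the left. -/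
theorem rotate_factor (ω : ℤ → Fin 2) (n : ℕ) (q : ℤ) (i : ℕ)
    (h : ∀ j : ℕ, 1 ≤ j → j ≤ i → ω (-j + q) = ω (-j + q + n)) :
    (factor ω (-i + q) n).rotate i = factor ω q n := by
  induction i with
  | zero => simp
  | succ i ih =>
    rw [← ih fun j h1 h2 => h j h1 (by omega)]
    cases n with
    | zero => simp
    | succ n =>
      rw [factor_succ, List.rotate_cons_succ, h (i + 1) (by omega) le_rfl]
      have e : (-((i + 1 : ℕ) : ℤ) + q + 1) = -i + q := by push_cast; ring
      have e' : (-((i + 1 : ℕ) : ℤ) + q + ((n + 1 : ℕ) : ℤ)) = -i + q + n := by push_cast; ring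
      rw [e, e', ← factor_succ_last]

namespace BiPartition

variable (P : BiPartition)

/-! ### One-sided readings of the vertical lines -/

/-- The closed horizontal bases `[0, s₁]` and `[-s₂, 0]` of the rectangles. -/
def closedBase : Fin 2 → Set ℝ := ![Icc 0 (P.s 0), Icc (-P.s 1) 0]

/-- The bases of the rectangles, made half-open: for `ε = true` they are closed on the left, and
for `ε = false` on the right. A point belongs to the half-open base of `c` if the points next to
it, on the right for `ε = true` and on the left for `ε = false`, belong to the open base. -/
def sideBase (ε : Bool) : Fin 2 → Set ℝ :=
  bif ε then ![Ico 0 (P.s 0), Ico (-P.s 1) 0] else ![Ioc 0 (P.s 0), Ioc (-P.s 1) 0]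

/-- The horizontal spine, made half-open in the same way. -/
def sideSpine (ε : Bool) : Set ℝ :=
  bif ε then Ico (-P.s 1) (P.s 0) else Ioc (-P.s 1) (P.s 0)

@[simp] theorem base_zero : P.base 0 = Ioo 0 (P.s 0) := rfl
@[simp] theorem base_one : P.base 1 = Ioo (-P.s 1) 0 := rfl
@[simp] theorem closedBase_zero : P.closedBase 0 = Icc 0 (P.s 0) := rfl
@[simp] theorem closedBase_one : P.closedBase 1 = Icc (-P.s 1) 0 := rfl
@[simp] theorem sideBase_true_zero : P.sideBase true 0 = Ico 0 (P.s 0) := rfl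
@[simp] theorem sideBase_true_one : P.sideBase true 1 = Ico (-P.s 1) 0 := rfl
@[simp] theorem sideBase_false_zero : P.sideBase false 0 = Ioc 0 (P.s 0) := rfl
@[simp] theorem sideBase_false_one : P.sideBase false 1 = Ioc (-P.s 1) 0 := rfl
@[simp] theorem sideSpine_true : P.sideSpine true = Ico (-P.s 1) (P.s 0) := rfl
@[simp] theorem sideSpine_false : P.sideSpine false = Ioc (-P.s 1) (P.s 0) := rfl

theorem base_subset_sideBase (ε : Bool) (c : Fin 2) : P.base c ⊆ P.sideBase ε c := by
  intro h hh
  obtain rfl | rfl := fin_two_eq_zero_or_one c <;> cases ε <;> simp at * <;>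
    constructor <;> linarith [hh.1, hh.2]

theorem sideBase_subset_closedBase (ε : Bool) (c : Fin 2) :
    P.sideBase ε c ⊆ P.closedBase c := by
  intro h hh
  obtain rfl | rfl := fin_two_eq_zero_or_one c <;> cases ε <;> simp at * <;>
    constructor <;> linarith [hh.1, hh.2]

theorem closedBase_subset (c : Fin 2) : P.closedBase c ⊆ Icc (-P.s 1) (P.s 0) := by
  have s0 := P.s_pos 0; have s1 := P.s_pos 1
  intro h hh
  obtain rfl | rfl := fin_two_eq_zero_or_one c <;> simp at * <;>
    constructor <;> linarith [hh.1, hh.2]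

theorem sideSpine_subset (ε : Bool) : P.sideSpine ε ⊆ Icc (-P.s 1) (P.s 0) := by
  intro h hh
  cases ε <;> simp at * <;> constructor <;> linarith [hh.1, hh.2]

theorem sideBase_subset_sideSpine (ε : Bool) (c : Fin 2) : P.sideBase ε c ⊆ P.sideSpine ε := by
  have s0 := P.s_pos 0; have s1 := P.s_pos 1
  intro h hh
  obtain rfl | rfl := fin_two_eq_zero_or_one c <;> cases ε <;> simp at * <;>
    constructor <;> linarith [hh.1, hh.2]

theorem Ioo_subset_sideSpine (ε : Bool) : Ioo (-P.s 1) (P.s 0) ⊆ P.sideSpine ε := by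
  intro h hh
  cases ε <;> simp at * <;> constructor <;> linarith [hh.1, hh.2]

theorem zero_mem_sideSpine (ε : Bool) : (0 : ℝ) ∈ P.sideSpine ε :=
  P.Ioo_subset_sideSpine ε ⟨neg_lt_zero.2 (P.s_pos 1), P.s_pos 0⟩

theorem exists_mem_sideBase {ε : Bool} {h : ℝ} (hh : h ∈ P.sideSpine ε) :
    ∃ c, h ∈ P.sideBase ε c := by
  rw [Fin.exists_fin_two]
  cases ε <;> simp at *
  · rcases lt_or_ge 0 h with h0 | h0
    · exact Or.inl ⟨h0, hh.2⟩
    · exact Or.inr ⟨hh.1, h0⟩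
  · rcases lt_or_ge h 0 with h0 | h0
    · exact Or.inr ⟨hh.1, h0⟩
    · exact Or.inl ⟨h0, hh.2⟩

theorem sideBase_unique {ε : Bool} {c c' : Fin 2} {h : ℝ} (hc : h ∈ P.sideBase ε c)
    (hc' : h ∈ P.sideBase ε c') : c = c' := by
  obtain rfl | rfl := fin_two_eq_zero_or_one c <;> obtain rfl | rfl := fin_two_eq_zero_or_one c' <;>
    cases ε <;> simp at * <;> linarith [hc.1, hc.2, hc'.1, hc'.2]

theorem closedBase_unique {ε : Bool} {c c' : Fin 2} {h : ℝ} (h0 : h ≠ 0)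
    (hc : h ∈ P.closedBase c) (hc' : h ∈ P.sideBase ε c') : c = c' := by
  have s0 := P.s_pos 0; have s1 := P.s_pos 1
  obtain h1 | h1 := lt_or_gt_of_ne h0 <;>
  obtain rfl | rfl := fin_two_eq_zero_or_one c <;> obtain rfl | rfl := fin_two_eq_zero_or_one c' <;>
    cases ε <;> simp at * <;> linarith [hc.1, hc.2, hc'.1, hc'.2]

/-- Passing through a tile maps its half-open base into the half-open spine. -/
theorem sub_latVec_mem_sideSpine {ε : Bool} {c : Fin 2} {h : ℝ} (hc : h ∈ P.sideBase ε c) :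
    h - P.latX (latVec c) ∈ P.sideSpine ε := by
  have s0 := P.s_pos 0; have s1 := P.s_pos 1
  obtain rfl | rfl := fin_two_eq_zero_or_one c <;> cases ε <;>
    simp only [latX_latVec_zero, latX_latVec_one] <;> simp at * <;>
    constructor <;> linarith [hc.1, hc.2]

theorem existsUnique_latPoint (ε : Bool) (y : ℝ) (n : ℤ) :
    ∃! z : ℤ × ℤ, latLen z = n ∧ y - P.latX z ∈ P.sideSpine ε := by
  have s0 := P.s_pos 0; have s1 := P.s_pos 1
  have hS : 0 < P.s 1 + P.s 0 := by linarith
  have key : ∃! m : ℤ, (y - P.s 1 * n) + m • (P.s 1 + P.s 0) ∈ P.sideSpine ε := by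
    have e : P.s 0 = -P.s 1 + (P.s 1 + P.s 0) := by ring
    cases ε
    · have := existsUnique_add_zsmul_mem_Ioc hS (y - P.s 1 * n) (-P.s 1)
      rw [← e] at this
      exact this
    · have := existsUnique_add_zsmul_mem_Ico hS (y - P.s 1 * n) (-P.s 1)
      rw [← e] at this
      exact this
  have conv : ∀ z : ℤ × ℤ, latLen z = n →
      y - P.latX z = (y - P.s 1 * n) + z.2 • (P.s 1 + P.s 0) := by
    rintro ⟨A, B⟩ rfl
    simp only [latX, latLen, zsmul_eq_mul]; push_cast; ring
  obtain ⟨m, hm, hu⟩ := key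
  refine ⟨(n - m, m), ⟨by simp [latLen], ?_⟩, ?_⟩
  · rw [conv _ (by simp [latLen])]; exact hm
  · rintro ⟨A, B⟩ ⟨h1, h2⟩
    rw [conv _ h1] at h2
    have : B = m := hu B h2
    simp only [latLen] at h1
    ext <;> simp <;> omega

/-- The integer coordinates of the lattice point at the corner of the `n`-th tile of the vertical
line through `(y, 0)`, where lines through lattice points are read on the side `ε`. -/
noncomputable def corner (ε : Bool) (y : ℝ) (n : ℤ) : ℤ × ℤ :=
  (P.existsUnique_latPoint ε y n).choose

/-- The bi-infinite word of the vertical line through `(y, 0)`, where lines through lattice points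
are read on the side `ε`. -/
noncomputable def word (ε : Bool) (y : ℝ) (n : ℤ) : Fin 2 :=
  (P.exists_mem_sideBase (P.existsUnique_latPoint ε y n).choose_spec.1.2).choose

theorem latLen_corner (ε : Bool) (y : ℝ) (n : ℤ) : latLen (P.corner ε y n) = n :=
  (P.existsUnique_latPoint ε y n).choose_spec.1.1

theorem sub_corner_mem_sideSpine (ε : Bool) (y : ℝ) (n : ℤ) :
    y - P.latX (P.corner ε y n) ∈ P.sideSpine ε :=
  (P.existsUnique_latPoint ε y n).choose_spec.1.2

theorem sub_corner_mem_sideBase (ε : Bool) (y : ℝ) (n : ℤ) :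
    y - P.latX (P.corner ε y n) ∈ P.sideBase ε (P.word ε y n) :=
  (P.exists_mem_sideBase (P.existsUnique_latPoint ε y n).choose_spec.1.2).choose_spec

variable {P}

theorem corner_eq {ε : Bool} {y : ℝ} {n : ℤ} {z : ℤ × ℤ} (hn : latLen z = n)
    (hz : y - P.latX z ∈ P.sideSpine ε) : P.corner ε y n = z :=
  ((P.existsUnique_latPoint ε y n).choose_spec.2 z ⟨hn, hz⟩).symm

theorem word_eq {ε : Bool} {y : ℝ} {n : ℤ} {z : ℤ × ℤ} {c : Fin 2} (hn : latLen z = n)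
    (hz : y - P.latX z ∈ P.sideBase ε c) : P.word ε y n = c := by
  have h := P.sub_corner_mem_sideBase ε y n
  rw [corner_eq hn (P.sideBase_subset_sideSpine ε c hz)] at h
  exact P.sideBase_unique h hz

theorem corner_zero {ε : Bool} {y : ℝ} (hy : y ∈ P.sideSpine ε) : P.corner ε y 0 = 0 :=
  corner_eq latLen_zero (by simpa using hy)

theorem corner_succ (ε : Bool) (y : ℝ) (n : ℤ) :
    P.corner ε y (n + 1) = P.corner ε y n + latVec (P.word ε y n) := by
  refine corner_eq (by rw [latLen_add, P.latLen_corner, latLen_latVec]) ?_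
  rw [P.latX_add, ← sub_sub]
  exact P.sub_latVec_mem_sideSpine (P.sub_corner_mem_sideBase ε y n)

theorem corner_sub (ε : Bool) (y : ℝ) (z : ℤ × ℤ) (n : ℤ) :
    P.corner ε (y - P.latX z) n = P.corner ε y (n + latLen z) - z := by
  refine corner_eq (by rw [latLen_sub, P.latLen_corner]; ring) ?_
  rw [P.latX_sub, sub_sub, add_sub_cancel]
  exact P.sub_corner_mem_sideSpine ε y _

theorem word_sub (ε : Bool) (y : ℝ) (z : ℤ × ℤ) (n : ℤ) :
    P.word ε (y - P.latX z) n = P.word ε y (n + latLen z) := by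
  refine word_eq (z := P.corner ε y (n + latLen z) - z)
    (by rw [latLen_sub, P.latLen_corner]; ring) ?_
  rw [P.latX_sub, sub_sub, add_sub_cancel]
  exact P.sub_corner_mem_sideBase ε y _

theorem factor_word_sub (ε : Bool) (y : ℝ) (z : ℤ × ℤ) (m : ℤ) (n : ℕ) :
    factor (P.word ε (y - P.latX z)) m n = factor (P.word ε y) (m + latLen z) n := by
  rw [← factor_shift]
  exact factor_congr fun k _ => P.word_sub ε y z _

theorem latY_corner_strictMono (ε : Bool) (y : ℝ) :
    StrictMono fun n => P.latY (P.corner ε y n) := by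
  refine strictMono_int_of_lt_succ fun n => ?_
  rw [corner_succ, P.latY_add, P.latY_latVec]
  linarith [P.u_pos (P.word ε y n)]

/-- The letters of a window of the word count the lattice steps between its ends. -/
theorem corner_add (ε : Bool) (y : ℝ) (m : ℤ) (n : ℕ) :
    P.corner ε y (m + n) = P.corner ε y m +
      (((factor (P.word ε y) m n).count 0 : ℤ), ((factor (P.word ε y) m n).count 1 : ℤ)) := by
  induction n with
  | zero => simp
  | succ n ih =>
    rw [factor_succ_last, Nat.cast_succ, ← add_assoc, corner_succ, ih, add_assoc]
    congr 1
    obtain h | h := fin_two_eq_zero_or_one (P.word ε y (m + n)) <;> rw [h] <;> simp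

end BiPartition

namespace BiPartition

variable (P : BiPartition)

/-! ### Tiles, cuts and intersection tilings in lattice coordinates -/

theorem rect_eq (c : Fin 2) : P.rect c = P.closedBase c ×ˢ Icc 0 (P.u c) := by
  obtain rfl | rfl := fin_two_eq_zero_or_one c <;> rfl

theorem mem_image_rect {p q : ℝ × ℝ} {c : Fin 2} :
    q ∈ (fun q => p + q) '' P.rect c ↔
      q.1 - p.1 ∈ P.closedBase c ∧ 0 ≤ q.2 - p.2 ∧ q.2 - p.2 ≤ P.u c := by
  rw [rect_eq]
  constructor
  · rintro ⟨a, ⟨h1, h2⟩, rfl⟩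
    simpa using ⟨h1, h2⟩
  · rintro ⟨h1, h2⟩
    exact ⟨q - p, ⟨h1, h2⟩, by simp⟩

theorem isTile_iff {v : ℝ × ℝ} {x y : ℝ} {c : Fin 2} :
    P.IsTile v x y c ↔
      ∃ z : ℤ × ℤ, x - v.1 - P.latX z ∈ P.closedBase c ∧ y = v.2 + P.latY z := by
  have hu := P.u_pos c
  constructor
  · rintro ⟨_, hz, h⟩
    obtain ⟨z, rfl⟩ := P.mem_lattice_iff.1 hz
    have h1 : (x, y) ∈ ({x} ×ˢ Icc y (y + P.u c) : Set (ℝ × ℝ)) :=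
      ⟨rfl, le_rfl, by linarith⟩
    have h2 : (x, y + P.u c) ∈ ({x} ×ˢ Icc y (y + P.u c) : Set (ℝ × ℝ)) :=
      ⟨rfl, by simpa using hu.le, le_rfl⟩
    rw [← h] at h1 h2
    have h1' := P.mem_image_rect.1 h1.2
    have h2' := P.mem_image_rect.1 h2.2
    simp only [Prod.fst_add, Prod.snd_add] at h1' h2'
    exact ⟨z, by rw [sub_sub]; exact h1'.1, by linarith [h1'.2.1, h2'.2.2]⟩
  · rintro ⟨z, hz, rfl⟩
    refine ⟨_, P.mem_lattice_iff.2 ⟨z, rfl⟩, ?_⟩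
    ext ⟨a, b⟩
    rw [mem_inter_iff, mem_image_rect]
    simp only [mem_ofPred_eq, Prod.fst_add, Prod.snd_add, mem_prod, mem_singleton_iff, mem_Icc]
    constructor
    · rintro ⟨rfl, -, h1, h2⟩
      exact ⟨rfl, by linarith, by linarith⟩
    · rintro ⟨rfl, h1, h2⟩
      exact ⟨rfl, by rwa [← sub_sub], by linarith, by linarith⟩

/-- The vertical line through `(x, 0)` passes from the lattice point `z` to the lattice point `z'`
through tiles whose types form the given word. -/
def Reads (x : ℝ) : ℤ × ℤ → ℤ × ℤ → List (Fin 2) → Prop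
  | z, z', [] => z = z'
  | z, z', c :: w => x - P.latX z ∈ P.closedBase c ∧ Reads x (z + latVec c) z' w

variable {P}

theorem Reads.latY_le {x : ℝ} {z z' : ℤ × ℤ} {w : List (Fin 2)} (h : P.Reads x z z' w) :
    P.latY z ≤ P.latY z' := by
  induction w generalizing z with
  | nil => exact (congrArg P.latY h).le
  | cons c w ih =>
    have := ih h.2
    rw [P.latY_add, P.latY_latVec] at this
    linarith [P.u_pos c]

theorem cutInto_iff (hY : Function.Injective P.latY) {v : ℝ × ℝ} {x : ℝ} {z z' : ℤ × ℤ}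
    {w : List (Fin 2)} :
    P.CutInto v x (v.2 + P.latY z) (v.2 + P.latY z') w ↔ P.Reads (x - v.1) z z' w := by
  induction w generalizing z with
  | nil => simp only [CutInto, Reads, add_right_inj, hY.eq_iff]
  | cons c w ih =>
    simp only [CutInto, Reads]
    rw [add_assoc, ← P.latY_latVec c, ← P.latY_add, ih, isTile_iff]
    refine and_congr_left fun _ => ⟨?_, fun h => ⟨z, h, rfl⟩⟩
    rintro ⟨z₁, h1, h2⟩
    rwa [hY (add_left_cancel h2)]

theorem reads_factor (ε : Bool) (y : ℝ) (m : ℤ) (n : ℕ) :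
    P.Reads y (P.corner ε y m) (P.corner ε y (m + n)) (factor (P.word ε y) m n) := by
  induction n generalizing m with
  | zero => simp [Reads]
  | succ n ih =>
    rw [factor_succ]
    refine ⟨P.sideBase_subset_closedBase _ _ (P.sub_corner_mem_sideBase ε y m), ?_⟩
    rw [← corner_succ, Nat.cast_succ, add_comm (n : ℤ), ← add_assoc]
    exact ih _

/-- As long as a line does not meet lattice points, its tiles are determined. -/
theorem Reads.eq_factor {ε : Bool} {y : ℝ} {m : ℤ} {n : ℕ} {w : List (Fin 2)}
    (h : P.Reads y (P.corner ε y m) (P.corner ε y (m + n)) w)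
    (h0 : ∀ k : ℕ, k < n → y - P.latX (P.corner ε y (m + k)) ≠ 0) :
    w = factor (P.word ε y) m n := by
  induction w generalizing m n with
  | nil =>
    have h1 : P.corner ε y m = P.corner ε y (m + n) := h
    have h2 := congrArg latLen h1
    rw [P.latLen_corner, P.latLen_corner] at h2
    have : n = 0 := by omega
    subst this
    rfl
  | cons c w ih =>
    cases n with
    | zero =>
      have := h.2.latY_le
      rw [P.latY_add, P.latY_latVec] at this
      simp only [Nat.cast_zero, add_zero] at this
      linarith [P.u_pos c]
    | succ n =>
      have hc : c = P.word ε y m := by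
        refine P.closedBase_unique ?_ h.1 (P.sub_corner_mem_sideBase ε y m)
        simpa using h0 0 (by omega)
      rw [factor_succ, hc]
      congr 1
      have h2 := h.2
      rw [hc, ← corner_succ] at h2
      refine ih (m := m + 1) (n := n) ?_ fun k hk => ?_
      · convert h2 using 2; push_cast; ring
      · have := h0 (k + 1) (by omega)
        convert this using 4; push_cast; ring

theorem IsTiling.of_word {ε : Bool} {x : ℝ} (hx : x ∈ P.sideSpine ε) :
    P.IsTiling x (P.word ε x) := by
  refine ⟨P.sideSpine_subset ε hx, fun n => P.latY (P.corner ε x n), ?_, fun n => ⟨?_, ?_⟩⟩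
  · beta_reduce; rw [corner_zero hx, P.latY_zero]
  · beta_reduce; rw [corner_succ, P.latY_add, P.latY_latVec]
  · refine P.isTile_iff.2 ⟨P.corner ε x n, ?_, by simp⟩
    simpa using P.sideBase_subset_closedBase _ _ (P.sub_corner_mem_sideBase ε x n)

/-- Every intersection tiling is read on one side of its line. -/
theorem IsTiling.exists_word (hX : Function.Injective P.latX) (hY : Function.Injective P.latY)
    {x : ℝ} {ω : ℤ → Fin 2} (h : P.IsTiling x ω) :
    ∃ ε, x ∈ P.sideSpine ε ∧ ω = P.word ε x := by
  have s0 := P.s_pos 0; have s1 := P.s_pos 1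
  obtain ⟨-, y, hy0, hy⟩ := h
  have hz : ∀ n, ∃ z : ℤ × ℤ, x - P.latX z ∈ P.closedBase (ω n) ∧ y n = P.latY z := by
    intro n
    simpa using P.isTile_iff.1 (hy n).2
  choose z hz hyz using hz
  have hz0 : z 0 = 0 := hY (by rw [← hyz, hy0, P.latY_zero])
  have hsucc : ∀ n, z (n + 1) = z n + latVec (ω n) := fun n => hY (by
    rw [← hyz, (hy n).1, hyz, P.latY_add, P.latY_latVec])
  have hlen : ∀ n, latLen (z n) = n := by
    intro n
    induction n with
    | zero => rw [hz0, latLen_zero]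
    | succ n ih => rw [hsucc, latLen_add, ih, latLen_latVec]
    | pred n ih =>
      have := hsucc (-n - 1)
      rw [sub_add_cancel] at this
      rw [this, latLen_add, latLen_latVec] at ih
      linarith
  -- a right end of the base of `a` or a left end of the base of `b` can only be reached from `0`
  have hprev : ∀ n, x - P.latX (z (n - 1)) = x - P.latX (z n) + P.latX (latVec (ω (n - 1))) := by
    intro n
    have := hsucc (n - 1)
    rw [sub_add_cancel] at this
    rw [this, P.latX_add]; ring
  suffices ∃ ε, ∀ n, x - P.latX (z n) ∈ P.sideBase ε (ω n) by
    obtain ⟨ε, hε⟩ := this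
    refine ⟨ε, ?_, funext fun n => (word_eq (hlen n) (hε n)).symm⟩
    have := P.sideBase_subset_sideSpine _ _ (hε 0)
    rwa [hz0, P.latX_zero, sub_zero] at this
  by_cases hex : ∃ n, x - P.latX (z n) = 0 ∧ ω n = 1
  · obtain ⟨m, hm, hωm⟩ := hex
    have huniq : ∀ n, x - P.latX (z n) = 0 → ω n = 1 := by
      intro n hn
      have : z n = z m := hX (by linarith)
      have : n = m := by rw [← hlen n, this, hlen]
      rw [this, hωm]
    refine ⟨false, fun n => ?_⟩
    have h1 := hz n
    have h2 := hz (n - 1)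
    rw [hprev] at h2
    obtain hω | hω := fin_two_eq_zero_or_one (ω n)
    · rw [hω] at h1 ⊢
      refine ⟨lt_of_le_of_ne h1.1 fun h => ?_, h1.2⟩
      rw [huniq n h.symm] at hω
      exact absurd hω (by decide)
    · rw [hω] at h1 ⊢
      refine ⟨lt_of_le_of_ne h1.1 fun h => ?_, h1.2⟩
      obtain hω' | hω' := fin_two_eq_zero_or_one (ω (n - 1))
      · have h3 := huniq (n - 1) (by rw [hprev, hω', P.latX_latVec_zero]; linarith)
        rw [h3] at hω'
        exact absurd hω' (by decide)
      · rw [hω', P.latX_latVec_one] at h2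
        have := h2.1
        linarith
  · push Not at hex
    refine ⟨true, fun n => ?_⟩
    have h1 := hz n
    have h2 := hz (n - 1)
    rw [hprev] at h2
    obtain hω | hω := fin_two_eq_zero_or_one (ω n)
    · rw [hω] at h1 ⊢
      refine ⟨h1.1, lt_of_le_of_ne h1.2 fun h => ?_⟩
      obtain hω' | hω' := fin_two_eq_zero_or_one (ω (n - 1))
      · rw [hω', P.latX_latVec_zero] at h2
        have := h2.2
        linarith
      · exact hex (n - 1) (by rw [hprev, hω', P.latX_latVec_one]; linarith) hω'
    · rw [hω] at h1 ⊢
      exact ⟨h1.1, lt_of_le_of_ne h1.2 fun h => hex n h hω⟩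

end BiPartition

namespace BiPartition

variable (P : BiPartition)

/-! ### Admissible translations -/

/-- The lattice point `w` is admissible: its height is at most `(lam - 1) (u₁ + u₂)`, and the
contraction `x ↦ mu x + latX w` maps the horizontal spine into itself. -/
structure Admissible (lam mu : ℝ) (w : ℤ × ℤ) : Prop where
  nonneg : 0 ≤ P.latY w
  le : P.latY w ≤ (lam - 1) * (P.u 0 + P.u 1)
  maps : ∀ x ∈ Icc (-P.s 1) (P.s 0), mu * x + P.latX w ∈ Icc (-P.s 1) (P.s 0)

/-- The side on which the image of a line is read, when the line is read on the side `ε`. -/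
noncomputable def imageSide (mu : ℝ) (ε : Bool) : Bool := if 0 < mu then ε else !ε

theorem imageSide_imageSide (mu : ℝ) (ε : Bool) : imageSide mu (imageSide mu ε) = ε := by
  unfold imageSide; split_ifs <;> simp

theorem imageSide_of_pos {mu : ℝ} (h : 0 < mu) (ε : Bool) : imageSide mu ε = ε := if_pos h

theorem imageSide_of_neg {mu : ℝ} (h : mu < 0) (ε : Bool) : imageSide mu ε = !ε :=
  if_neg h.not_gt

namespace IsEigen

variable {P} {F : Matrix (Fin 2) (Fin 2) ℕ} {lam mu : ℝ} (E : P.IsEigen F lam mu)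
include E

theorem exists_preimage (z : ℤ × ℤ) :
    ∃ v : ℤ × ℤ, P.latX z = mu * P.latX v ∧ P.latY z = lam * P.latY v := by
  obtain ⟨v, rfl⟩ := E.exists_latAct_eq z
  exact ⟨v, E.latX_act v, E.latY_act v⟩

theorem latY_act_latVec (c : Fin 2) : P.latY (latAct F (latVec c)) = lam * P.u c := by
  rw [E.latY_act, P.latY_latVec]

/-- A lattice point above the spine which is not too high is admissible: if the image of the spine
stuck out of the spine, the preimage of a lattice point next to `w` would violate
`no_latVec_between`. -/
theorem admissible_of_mem {w : ℤ × ℤ} (h : P.latX w ∈ Icc (-P.s 1) (P.s 0))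
    (h0 : 0 ≤ P.latY w) (h1 : P.latY w ≤ (lam - 1) * (P.u 0 + P.u 1)) :
    P.Admissible lam mu w := by
  have s0 := P.s_pos 0; have s1 := P.s_pos 1; have u0 := P.u_pos 0; have u1 := P.u_pos 1
  have l1 := E.one_lt
  have habs := abs_lt.1 E.abs_mu_lt_one
  -- the preimage of the lattice point next to the end that sticks out has a small abscissa
  have key : ∀ x ∈ Icc (-P.s 1) (P.s 0), ∀ a : ℝ,
      (-(mu * x) < mu * a ∧ mu * a ≤ 0 ∨ 0 ≤ mu * a ∧ mu * a < -(mu * x)) →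
      -P.s 0 < a ∧ a < P.s 1 := by
    intro x hx a ha
    obtain ⟨hx1, hx2⟩ := hx
    rcases lt_or_gt_of_ne E.mu_ne_zero with hmu | hmu
    · rcases ha with ⟨ha1, ha2⟩ | ⟨ha1, ha2⟩
      · have : 0 ≤ a := by by_contra hc; nlinarith
        have : a < -x := by by_contra hc; nlinarith
        constructor <;> linarith
      · have : a ≤ 0 := by by_contra hc; nlinarith
        have : -x < a := by by_contra hc; nlinarith
        constructor <;> linarith
    · rcases ha with ⟨ha1, ha2⟩ | ⟨ha1, ha2⟩
      · have : a ≤ 0 := by by_contra hc; nlinarith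
        have : -x < a := by by_contra hc; nlinarith
        constructor <;> linarith
      · have : 0 ≤ a := by by_contra hc; nlinarith
        have : a < -x := by by_contra hc; nlinarith
        constructor <;> linarith
  have hY : ∀ c : Fin 2, ∀ y : ℝ, P.latY w + P.u c = lam * y → 0 < y ∧ y < P.u 0 + P.u 1 := by
    intro c y hy
    have hc := P.u_pos c
    have hc' : P.u c < P.u 0 + P.u 1 := by
      obtain rfl | rfl := fin_two_eq_zero_or_one c <;> linarith
    constructor
    · by_contra hcon; nlinarith
    · by_contra hcon; nlinarith
  refine ⟨h0, h1, fun x hx => ?_⟩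
  by_contra hcon
  rw [mem_Icc, not_and_or, not_le, not_le] at hcon
  rcases hcon with hcon | hcon
  · obtain ⟨v, hvx, hvy⟩ := E.exists_preimage (w + latVec 0)
    rw [P.latX_add, P.latX_latVec_zero] at hvx
    rw [P.latY_add, P.latY_latVec] at hvy
    have hX := key x hx (P.latX v) (Or.inr ⟨by linarith [h.1], by linarith⟩)
    exact P.no_latVec_between hX.1 hX.2 (hY 0 _ hvy).1 (hY 0 _ hvy).2
  · obtain ⟨v, hvx, hvy⟩ := E.exists_preimage (w + latVec 1)
    rw [P.latX_add, P.latX_latVec_one] at hvx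
    rw [P.latY_add, P.latY_latVec] at hvy
    have hX := key x hx (P.latX v) (Or.inl ⟨by linarith, by linarith [h.2]⟩)
    exact P.no_latVec_between hX.1 hX.2 (hY 1 _ hvy).1 (hY 1 _ hvy).2

theorem admissible_zero : P.Admissible lam mu 0 := by
  have s0 := P.s_pos 0; have s1 := P.s_pos 1; have u0 := P.u_pos 0; have u1 := P.u_pos 1
  have l1 := E.one_lt
  refine E.admissible_of_mem ?_ ?_ ?_ <;> simp
  · exact ⟨s1.le, s0.le⟩
  · exact mul_nonneg (by linarith) (by linarith)

end IsEigen

namespace Admissible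

variable {P} {F : Matrix (Fin 2) (Fin 2) ℕ} {lam mu : ℝ} {w : ℤ × ℤ}

theorem maps_Ioo (hw : P.Admissible lam mu w) (hmu : mu ≠ 0) {x : ℝ}
    (hx : x ∈ Ioo (-P.s 1) (P.s 0)) : mu * x + P.latX w ∈ Ioo (-P.s 1) (P.s 0) := by
  have s0 := P.s_pos 0; have s1 := P.s_pos 1
  have h1 := hw.maps (-P.s 1) ⟨le_rfl, by linarith⟩
  have h2 := hw.maps (P.s 0) ⟨by linarith, le_rfl⟩
  obtain ⟨hx1, hx2⟩ := hx
  rcases lt_or_gt_of_ne hmu with hmu | hmu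
  · constructor <;> nlinarith [h1.1, h1.2, h2.1, h2.2]
  · constructor <;> nlinarith [h1.1, h1.2, h2.1, h2.2]

theorem maps_sideSpine (hw : P.Admissible lam mu w) (hmu : mu ≠ 0) {ε : Bool} {x : ℝ}
    (hx : x ∈ P.sideSpine ε) : mu * x + P.latX w ∈ P.sideSpine (imageSide mu ε) := by
  have s0 := P.s_pos 0; have s1 := P.s_pos 1
  have h1 := hw.maps (-P.s 1) ⟨le_rfl, by linarith⟩
  have h2 := hw.maps (P.s 0) ⟨by linarith, le_rfl⟩
  rcases lt_or_gt_of_ne hmu with hmu | hmu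
  · rw [imageSide_of_neg hmu]
    cases ε <;> simp at hx ⊢ <;> obtain ⟨hx1, hx2⟩ := hx <;>
      constructor <;> nlinarith [h1.1, h1.2, h2.1, h2.2]
  · rw [imageSide_of_pos hmu]
    cases ε <;> simp at hx ⊢ <;> obtain ⟨hx1, hx2⟩ := hx <;>
      constructor <;> nlinarith [h1.1, h1.2, h2.1, h2.2]

theorem latX_mem_Ioo (hw : P.Admissible lam mu w) (hmu : mu ≠ 0) :
    P.latX w ∈ Ioo (-P.s 1) (P.s 0) := by
  simpa using hw.maps_Ioo hmu (x := 0) ⟨neg_lt_zero.2 (P.s_pos 1), P.s_pos 0⟩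

theorem corner_neg (hw : P.Admissible lam mu w) (hmu : mu ≠ 0) (ε : Bool) :
    P.corner ε 0 (-latLen w) = -w := by
  refine corner_eq (latLen_neg w) ?_
  rw [P.latX_neg, zero_sub, neg_neg]
  exact P.Ioo_subset_sideSpine ε (hw.latX_mem_Ioo hmu)

end Admissible

namespace IsEigen

variable {P} {F : Matrix (Fin 2) (Fin 2) ℕ} {lam mu : ℝ} (E : P.IsEigen F lam mu)
include E

/-- The highest admissible lattice point is attached to the upper end of the vertical spine. -/
theorem admissible_last : P.Admissible lam mu (latAct F (1, 1) - (1, 1)) := by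
  have s0 := P.s_pos 0; have s1 := P.s_pos 1; have u0 := P.u_pos 0; have u1 := P.u_pos 1
  have l1 := E.one_lt
  have hX1 : P.latX (1, 1) = P.s 1 - P.s 0 := by simp [latX]
  have hY1 : P.latY (1, 1) = P.u 0 + P.u 1 := by simp [latY]
  have hY : P.latY (latAct F (1, 1) - (1, 1)) = (lam - 1) * (P.u 0 + P.u 1) := by
    rw [P.latY_sub, E.latY_act, hY1]; ring
  refine E.admissible_of_mem ?_ ?_ hY.le
  · rw [P.latX_sub, E.latX_act, hX1]
    rcases lt_or_gt_of_ne E.mu_ne_zero with hmu | hmu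
    · obtain ⟨h1, h2⟩ := E.le_of_mu_neg hmu
      have h3 : lam * mu = -1 := by
        rcases E.mul_cases with h | h
        · nlinarith
        · exact h
      have h4 : -mu * P.s 0 ≤ P.s 1 := by nlinarith
      have h5 : -mu * P.s 1 ≤ P.s 0 := by nlinarith
      constructor <;> nlinarith
    · have := (abs_lt.1 E.abs_mu_lt_one).2
      constructor <;> nlinarith
  · rw [hY]; exact mul_nonneg (by linarith) (by linarith)

/-- The number of admissible points is the sum of the entries of `F` minus one; they are numbered
by their length `latLen`. -/
theorem admissible_neg_corner_iff (i : ℤ) :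
    P.Admissible lam mu (-P.corner true 0 (-i)) ↔
      0 ≤ i ∧ i < (F 0 0 + F 0 1 + F 1 0 + F 1 1 - 1 : ℕ) := by
  have hp0 := E.row_pos 0
  have hp1 := E.row_pos 1
  have hl := E.admissible_last
  have hmono := latY_corner_strictMono (P := P) true 0
  have hcl := hl.corner_neg E.mu_ne_zero true
  have hlen : latLen (latAct F (1, 1) - (1, 1)) = F 0 0 + F 0 1 + F 1 0 + F 1 1 - 2 := by
    simp [latLen, latAct]; ring
  have hYl : P.latY (latAct F (1, 1) - (1, 1)) = (lam - 1) * (P.u 0 + P.u 1) := by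
    rw [P.latY_sub, E.latY_act]; simp [latY]; ring
  have hc0 : P.corner true 0 0 = 0 := corner_zero (P.zero_mem_sideSpine true)
  have key : ∀ i : ℤ, (0 ≤ P.latY (-P.corner true 0 (-i)) ↔ 0 ≤ i) ∧
      (P.latY (-P.corner true 0 (-i)) ≤ (lam - 1) * (P.u 0 + P.u 1) ↔
        i ≤ F 0 0 + F 0 1 + F 1 0 + F 1 1 - 2) := by
    intro i
    have h1 := hmono.le_iff_le (a := -i) (b := 0)
    have h2 := hmono.le_iff_le (a := -latLen (latAct F (1, 1) - (1, 1))) (b := -i)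
    beta_reduce at h1 h2
    rw [hcl] at h2
    rw [hc0, P.latY_zero] at h1
    rw [P.latY_neg, hlen] at h2
    rw [P.latY_neg, neg_nonneg, h1, ← hYl]
    refine ⟨by omega, fun h => ?_, fun h => ?_⟩
    · have := h2.1 (by linarith)
      omega
    · have := h2.2 (by omega)
      linarith
  have e : ((F 0 0 + F 0 1 + F 1 0 + F 1 1 - 1 : ℕ) : ℤ) =
      (F 0 0 : ℤ) + F 0 1 + F 1 0 + F 1 1 - 1 := by omega
  rw [e]
  constructor
  · intro h
    have h1 := (key i).1.1 h.nonneg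
    have h2 := (key i).2.1 h.le
    omega
  · rintro ⟨h1, h2⟩
    refine E.admissible_of_mem ?_ ((key i).1.2 h1) ((key i).2.2 (by omega))
    have := P.sideSpine_subset _ (P.sub_corner_mem_sideSpine true 0 (-i))
    rwa [zero_sub, ← P.latX_neg] at this

/-- The image of a vertical segment through the interior of the rectangle `c` contains no lattice
points, and neither does its continuation downwards by less than `u₁ + u₂`: the preimage of such a
point would violate `no_latVec_in_column`. Heights are measured from the lower end of the image. -/
theorem no_crossing {w : ℤ × ℤ} (hw : P.Admissible lam mu w) {c : Fin 2} {x : ℝ}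
    (hx : x ∈ P.base c) {z : ℤ × ℤ} (h1 : -(P.u 0 + P.u 1) < P.latY z)
    (h2 : P.latY z < lam * P.u c) : P.latX z ≠ mu * x + P.latX w := by
  intro h
  have u0 := P.u_pos 0; have u1 := P.u_pos 1
  have l1 := E.one_lt
  have hw0 := hw.nonneg
  have hw1 := hw.le
  obtain ⟨v, hvx, hvy⟩ := E.exists_preimage (z - w)
  rw [P.latX_sub, h, add_sub_cancel_right] at hvx
  rw [P.latY_sub] at hvy
  rw [mul_left_cancel₀ E.mu_ne_zero hvx] at hx
  refine P.no_latVec_in_column hx ?_ ?_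
  · by_contra hcon; nlinarith
  · by_contra hcon; nlinarith

/-- The image line does not cross lattice points when its preimage moves from a point `x₀` of the
closed base to an interior point `x₁`. -/
theorem no_crossing_between {w : ℤ × ℤ} (hw : P.Admissible lam mu w) {c : Fin 2} {x₀ x₁ : ℝ}
    (h₀ : x₀ ∈ P.closedBase c) (h₁ : x₁ ∈ P.base c) {z : ℤ × ℤ}
    (h1 : -(P.u 0 + P.u 1) < P.latY z) (h2 : P.latY z < lam * P.u c)
    (h : P.latX z - P.latX w ∈ Ioc (mu * x₀) (mu * x₁) ∪ Ico (mu * x₁) (mu * x₀)) : False := by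
  set x := (P.latX z - P.latX w) / mu with hx
  have hxe : P.latX z - P.latX w = mu * x := by rw [hx]; field_simp [E.mu_ne_zero]
  rw [hxe] at h
  refine E.no_crossing hw (x := x) (c := c) ?_ h1 h2 (by linarith)
  have hx' : x ∈ Ioc x₀ x₁ ∪ Ico x₁ x₀ := by
    rcases lt_or_gt_of_ne E.mu_ne_zero with hmu | hmu
    · simpa [hmu, or_comm, and_comm] using h
    · simpa [hmu] using h
  obtain rfl | rfl := fin_two_eq_zero_or_one c <;> simp at h₀ h₁ hx' ⊢ <;>
    rcases hx' with hx' | hx' <;> constructor <;> linarith [h₀.1, h₀.2, h₁.1, h₁.2, hx'.1, hx'.2]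

/-- Sliding the preimage from `x₀` to a point `x₁` on the side `ε` of `x₀` does not change the tiles
that the image line passes through. The lattice point that would be crossed at an end of a base is
the corner `z` of the tile, or one of the possible corners `z - e₀` and `z - f₀` of the tile below. -/
theorem slide {w : ℤ × ℤ} (hw : P.Admissible lam mu w) {c c' : Fin 2} {ε : Bool} {x₀ x₁ : ℝ}
    (h₀ : x₀ ∈ P.closedBase c) (h₁ : x₁ ∈ P.base c) (hε : bif ε then x₀ < x₁ else x₁ < x₀)
    {z : ℤ × ℤ} (h1 : 0 ≤ P.latY z) (h2 : P.latY z < lam * P.u c)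
    (h : mu * x₀ + P.latX w - P.latX z ∈ P.sideBase (imageSide mu ε) c') :
    mu * x₁ + P.latX w - P.latX z ∈ P.base c' := by
  have u0 := P.u_pos 0; have u1 := P.u_pos 1
  have k0 := fun hh => E.no_crossing_between hw h₀ h₁ (z := z) (by linarith) h2 hh
  have k1 := fun hh => E.no_crossing_between hw h₀ h₁ (z := z - latVec 0)
    (by rw [P.latY_sub, P.latY_latVec]; linarith)
    (by rw [P.latY_sub, P.latY_latVec]; linarith) hh
  have k2 := fun hh => E.no_crossing_between hw h₀ h₁ (z := z - latVec 1)
    (by rw [P.latY_sub, P.latY_latVec]; linarith)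
    (by rw [P.latY_sub, P.latY_latVec]; linarith) hh
  rw [P.latX_sub, P.latX_latVec_zero] at k1
  rw [P.latX_sub, P.latX_latVec_one] at k2
  have hdir : (imageSide mu ε = true ∧ mu * x₀ < mu * x₁) ∨
      (imageSide mu ε = false ∧ mu * x₁ < mu * x₀) := by
    rcases lt_or_gt_of_ne E.mu_ne_zero with hmu | hmu
    · rw [imageSide_of_neg hmu]
      cases ε <;> simpa [hmu] using hε
    · rw [imageSide_of_pos hmu]
      cases ε <;> simpa [hmu] using hε
  rcases hdir with ⟨hi, hd⟩ | ⟨hi, hd⟩ <;> rw [hi] at h <;>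
    obtain rfl | rfl := fin_two_eq_zero_or_one c' <;> simp at h ⊢ <;> obtain ⟨ha, hb⟩ := h
  · refine ⟨by linarith, ?_⟩
    by_contra hcon
    exact k2 (Or.inl ⟨by linarith, by linarith⟩)
  · refine ⟨by linarith, ?_⟩
    by_contra hcon
    exact k0 (Or.inl ⟨by linarith, by linarith⟩)
  · refine ⟨?_, by linarith⟩
    by_contra hcon
    exact k0 (Or.inr ⟨by linarith, by linarith⟩)
  · refine ⟨?_, by linarith⟩
    by_contra hcon
    exact k1 (Or.inr ⟨by linarith, by linarith⟩)

end IsEigen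

end BiPartition

namespace BiPartition

variable (P : BiPartition)

/-! ### The substitution of an admissible translation -/

/-- The left ends of the bases of the rectangles. -/
def leftEnd : Fin 2 → ℝ := ![0, -P.s 1]

@[simp] theorem leftEnd_zero : P.leftEnd 0 = 0 := rfl
@[simp] theorem leftEnd_one : P.leftEnd 1 = -P.s 1 := rfl

theorem leftEnd_mem_sideBase (c : Fin 2) : P.leftEnd c ∈ P.sideBase true c := by
  have s0 := P.s_pos 0; have s1 := P.s_pos 1
  obtain rfl | rfl := fin_two_eq_zero_or_one c <;> simp <;> assumption

theorem leftEnd_lt {c : Fin 2} {x : ℝ} (hx : x ∈ P.base c) : P.leftEnd c < x := by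
  obtain rfl | rfl := fin_two_eq_zero_or_one c <;> exact hx.1

theorem base_nonempty (c : Fin 2) : (P.base c).Nonempty := by
  have s0 := P.s_pos 0; have s1 := P.s_pos 1
  obtain rfl | rfl := fin_two_eq_zero_or_one c <;> simp <;> assumption

/-- The substitution of an admissible lattice point `w`: the words of the images of the vertical
segments through the two rectangles, read next to their left sides. -/
noncomputable def subst (F : Matrix (Fin 2) (Fin 2) ℕ) (mu : ℝ) (w : ℤ × ℤ) : Substitution :=
  fun c => factor (P.word (imageSide mu true) (mu * P.leftEnd c + P.latX w)) 0 (F 0 c + F 1 c)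

theorem length_subst (F : Matrix (Fin 2) (Fin 2) ℕ) (mu : ℝ) (w : ℤ × ℤ) (c : Fin 2) :
    (P.subst F mu w c).length = F 0 c + F 1 c := by
  simp [subst]

namespace IsEigen

variable {P} {F : Matrix (Fin 2) (Fin 2) ℕ} {lam mu : ℝ} (E : P.IsEigen F lam mu)
  {w : ℤ × ℤ} (hw : P.Admissible lam mu w)
include E hw

theorem corner_image_zero {c : Fin 2} {ε : Bool} {x : ℝ} (hx : x ∈ P.sideBase ε c) :
    P.corner (imageSide mu ε) (mu * x + P.latX w) 0 = 0 :=
  corner_zero (hw.maps_sideSpine E.mu_ne_zero (P.sideBase_subset_sideSpine ε c hx))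

/-- The image of a vertical segment through the rectangle `c` passes through as many tiles as the
`c`-th column of `F` says. -/
theorem corner_image_end {c : Fin 2} {ε : Bool} {x : ℝ} (hx : x ∈ P.sideBase ε c) :
    P.corner (imageSide mu ε) (mu * x + P.latX w) (F 0 c + F 1 c : ℕ) =
      latAct F (latVec c) := by
  refine corner_eq (latLen_latAct_latVec F c) ?_
  have := hw.maps_sideSpine E.mu_ne_zero (P.sub_latVec_mem_sideSpine hx)
  rw [E.latX_act]
  convert this using 1
  ring

theorem latY_corner_image {c : Fin 2} {ε : Bool} {x : ℝ} (hx : x ∈ P.sideBase ε c) {k : ℕ}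
    (hk : k < F 0 c + F 1 c) :
    0 ≤ P.latY (P.corner (imageSide mu ε) (mu * x + P.latX w) k) ∧
      P.latY (P.corner (imageSide mu ε) (mu * x + P.latX w) k) < lam * P.u c := by
  have hm := latY_corner_strictMono (P := P) (imageSide mu ε) (mu * x + P.latX w)
  constructor
  · have := hm.monotone (a := 0) (b := (k : ℤ)) (by omega)
    beta_reduce at this
    rwa [E.corner_image_zero hw hx, P.latY_zero] at this
  · have := hm (a := (k : ℤ)) (b := (F 0 c + F 1 c : ℕ)) (by exact_mod_cast hk)
    beta_reduce at this
    rwa [E.corner_image_end hw hx, E.latY_act_latVec] at this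

theorem slide_corner {c : Fin 2} {ε : Bool} {x₀ x₁ : ℝ} (h₀ : x₀ ∈ P.sideBase ε c)
    (h₁ : x₁ ∈ P.base c) (hε : bif ε then x₀ < x₁ else x₁ < x₀) {k : ℕ}
    (hk : k < F 0 c + F 1 c) :
    mu * x₁ + P.latX w - P.latX (P.corner (imageSide mu ε) (mu * x₀ + P.latX w) k) ∈
      P.base (P.word (imageSide mu ε) (mu * x₀ + P.latX w) k) :=
  E.slide hw (P.sideBase_subset_closedBase _ _ h₀) h₁ hε (E.latY_corner_image hw h₀ hk).1
    (E.latY_corner_image hw h₀ hk).2 (P.sub_corner_mem_sideBase _ _ _)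

/-- The word of the image of a vertical segment through a rectangle does not depend on the
segment. -/
theorem factor_word_image {c : Fin 2} {ε : Bool} {x : ℝ} (hx : x ∈ P.sideBase ε c) :
    factor (P.word (imageSide mu ε) (mu * x + P.latX w)) 0 (F 0 c + F 1 c) =
      P.subst F mu w c := by
  obtain ⟨x₁, h₁, hε⟩ : ∃ x₁ ∈ P.base c, bif ε then x < x₁ else x₁ < x := by
    have s0 := P.s_pos 0; have s1 := P.s_pos 1
    obtain rfl | rfl := fin_two_eq_zero_or_one c <;> cases ε <;> simp at hx ⊢
    · exact ⟨x / 2, ⟨by linarith, by linarith⟩, by linarith⟩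
    · exact ⟨(x + P.s 0) / 2, ⟨by linarith, by linarith⟩, by linarith⟩
    · exact ⟨(x - P.s 1) / 2, ⟨by linarith, by linarith⟩, by linarith⟩
    · exact ⟨x / 2, ⟨by linarith, by linarith⟩, by linarith⟩
  have key : ∀ {ε : Bool} {x₀ : ℝ}, x₀ ∈ P.sideBase ε c → (bif ε then x₀ < x₁ else x₁ < x₀) →
      factor (P.word (imageSide mu ε) (mu * x₀ + P.latX w)) 0 (F 0 c + F 1 c) =
        factor (P.word true (mu * x₁ + P.latX w)) 0 (F 0 c + F 1 c) := by
    intro ε x₀ h₀ hε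
    refine factor_congr fun k hk => ?_
    rw [zero_add]
    exact (word_eq (P.latLen_corner _ _ _)
      (P.base_subset_sideBase _ _ (E.slide_corner hw h₀ h₁ hε hk))).symm
  rw [key hx hε, subst, key (P.leftEnd_mem_sideBase c) (P.leftEnd_lt h₁)]

theorem image_ne_zero {c : Fin 2} {x : ℝ} (hx : x ∈ P.base c) (ε : Bool) {k : ℕ}
    (hk : k < F 0 c + F 1 c) :
    mu * x + P.latX w - P.latX (P.corner ε (mu * x + P.latX w) k) ≠ 0 := by
  have u0 := P.u_pos 0; have u1 := P.u_pos 1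
  have h := E.latY_corner_image hw (P.base_subset_sideBase (imageSide mu ε) c hx) hk
  rw [imageSide_imageSide] at h
  exact sub_ne_zero.2 (E.no_crossing hw hx (by linarith) h.2).symm

theorem reads_image_iff {c : Fin 2} {x : ℝ} (hx : x ∈ P.base c) {l : List (Fin 2)} :
    P.Reads (mu * x) (-w) (latAct F (latVec c) - w) l ↔ l = P.subst F mu w c := by
  have hx' := P.base_subset_sideBase (imageSide mu true) c hx
  have e : mu * x = (mu * x + P.latX w) - P.latX w := by ring
  have hc : ∀ n : ℤ, P.corner true (mu * x) n =
      P.corner true (mu * x + P.latX w) (n + latLen w) - w := fun n => by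
    rw [← corner_sub, ← e]
  have h0 := E.corner_image_zero hw hx'
  have h1 := E.corner_image_end hw hx'
  have h2 := E.factor_word_image hw hx'
  rw [imageSide_imageSide] at h0 h1 h2
  have hf : factor (P.word true (mu * x)) (-latLen w) (F 0 c + F 1 c) = P.subst F mu w c := by
    rw [← h2]
    conv_lhs => rw [e]
    rw [factor_word_sub, neg_add_cancel]
  have hs : P.corner true (mu * x) (-latLen w) = -w := by
    rw [hc, neg_add_cancel, h0, zero_sub]
  have ht : P.corner true (mu * x) (-latLen w + (F 0 c + F 1 c : ℕ)) =
      latAct F (latVec c) - w := by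
    rw [hc, neg_add_cancel_comm, h1]
  rw [← hs, ← ht]
  constructor
  · intro h
    rw [← hf]
    refine h.eq_factor fun k hk => ?_
    have := E.image_ne_zero hw hx true hk
    rw [hc, neg_add_cancel_comm, P.latX_sub]
    convert this using 1
    ring
  · rintro rfl
    rw [← hf]
    exact reads_factor _ _ _ _

theorem subst_hasMatrix : (P.subst F mu w).HasMatrix F := by
  intro i c
  have hx := P.leftEnd_mem_sideBase c
  have h := corner_add (P := P) (imageSide mu true) (mu * P.leftEnd c + P.latX w) 0 (F 0 c + F 1 c)
  rw [zero_add, E.corner_image_end hw hx, E.corner_image_zero hw hx, zero_add, latAct_latVec,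
    Prod.mk.injEq, Nat.cast_inj, Nat.cast_inj] at h
  obtain rfl | rfl := fin_two_eq_zero_or_one i
  · exact h.1.symm
  · exact h.2.symm

/-- The substitution maps the word of a line to the word of the image line. -/
theorem subst_isImage {ε : Bool} {x : ℝ} (hx : x ∈ P.sideSpine ε) :
    (P.subst F mu w).IsImage (P.word ε x) (P.word (imageSide mu ε) (mu * x + P.latX w)) := by
  refine ⟨fun n => latLen (latAct F (P.corner ε x n)), ?_, fun n => ⟨?_, ?_⟩⟩
  · beta_reduce; rw [corner_zero hx, latAct_zero, latLen_zero]
  · beta_reduce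
    rw [corner_succ, latAct_add, latLen_add, latLen_latAct_latVec, P.length_subst]
  · rw [P.length_subst, ← E.factor_word_image hw (P.sub_corner_mem_sideBase ε x n)]
    have e : mu * (x - P.latX (P.corner ε x n)) + P.latX w =
        (mu * x + P.latX w) - P.latX (latAct F (P.corner ε x n)) := by rw [E.latX_act]; ring
    rw [e, factor_word_sub, zero_add]

end IsEigen

end BiPartition

theorem Substitution.IsImage.isRightImage {σ : Substitution} {ω ω' : ℤ → Fin 2}
    (h : σ.IsImage ω ω') : σ.IsRightImage ω ω' := by
  obtain ⟨N, h0, hN⟩ := h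
  exact ⟨N, h0, fun n _ => hN n⟩

namespace BiPartition

variable (P : BiPartition)

/-! ### Berg partitions and their substitutions -/

theorem mem_place {v : ℝ × ℝ} {S : Set (ℝ × ℝ)} {a : P.Torus} :
    a ∈ P.place v S ↔ ∃ q ∈ S, P.proj (v + q) = a := by
  rw [place, image_image]
  rfl

namespace IsEigen

variable {P} {F : Matrix (Fin 2) (Fin 2) ℕ} {lam mu : ℝ} (E : P.IsEigen F lam mu)
include E

theorem isBerg_iff {τ : ℝ} (hτ : τ ∈ Icc 0 (P.u 0 + P.u 1)) :
    P.IsBerg F (0, -τ) ↔ ∃ w, P.Admissible lam mu w ∧ P.latY w = (lam - 1) * τ := by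
  have s0 := P.s_pos 0; have s1 := P.s_pos 1; have u0 := P.u_pos 0; have u1 := P.u_pos 1
  have l1 := E.one_lt
  have l0 := E.lam_pos
  constructor
  · rintro ⟨h, -⟩
    have key : ∀ x ∈ Icc (-P.s 1) (P.s 0), ∃ z : ℤ × ℤ, P.latY z = (lam - 1) * τ ∧
        mu * x + P.latX z ∈ Icc (-P.s 1) (P.s 0) := by
      intro x hx
      have hm : P.proj ((0, -τ) + (x, 0)) ∈ P.place (0, -τ) P.hSpine :=
        P.mem_place.2 ⟨(x, 0), ⟨hx, rfl⟩, rfl⟩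
      obtain ⟨⟨x', y'⟩, ⟨hx', hy'⟩, he⟩ := P.mem_place.1 (h ⟨_, hm, rfl⟩)
      rw [mem_singleton_iff] at hy'
      rw [E.toralMap_proj, eq_comm, P.proj_eq_iff] at he
      obtain ⟨z, hz⟩ := he
      simp only [Prod.mk_add_mk, Prod.mk.injEq, zero_add, add_zero] at hz hy'
      rw [hy'] at hz
      exact ⟨z, by linarith [hz.2], by rw [← hz.1]; exact hx'⟩
    obtain ⟨w, hw, -⟩ := key 0 ⟨by linarith, s0.le⟩
    refine ⟨w, ⟨?_, ?_, fun x hx => ?_⟩, hw⟩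
    · rw [hw]; exact mul_nonneg (by linarith) hτ.1
    · rw [hw]; exact mul_le_mul_of_nonneg_left hτ.2 (by linarith)
    · obtain ⟨z, hz, hz'⟩ := key x hx
      rwa [E.latY_injective (hz.trans hw.symm)] at hz'
  · rintro ⟨w, hw, hwτ⟩
    constructor
    · rintro _ ⟨_, hm, rfl⟩
      obtain ⟨⟨x, y⟩, ⟨hx, hy⟩, rfl⟩ := P.mem_place.1 hm
      rw [mem_singleton_iff] at hy
      refine P.mem_place.2 ⟨(mu * x + P.latX w, 0), ⟨hw.maps x hx, rfl⟩, ?_⟩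
      rw [E.toralMap_proj, eq_comm, P.proj_eq_iff]
      refine ⟨w, ?_⟩
      simp only at hy
      ext
      · simp
      · simp [hy, hwτ]; ring
    · intro a ha
      obtain ⟨⟨x, y⟩, ⟨hx, hy⟩, rfl⟩ := P.mem_place.1 ha
      rw [mem_singleton_iff] at hx
      -- the preimage of the spine is shorter, since `F` expands the vertical direction about the
      -- origin, a point of the spine
      refine ⟨P.proj ((0, -τ) + (0, τ + (y - τ) / lam)), P.mem_place.2
        ⟨(0, τ + (y - τ) / lam), ⟨rfl, ?_, ?_⟩, rfl⟩, ?_⟩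
      · have h1 : -τ / lam ≤ (y - τ) / lam := by
          apply div_le_div_of_nonneg_right _ l0.le
          have := hy.1
          simp only at this
          linarith
        have h2 : -τ ≤ -τ / lam := by
          rw [le_div_iff₀ l0]; nlinarith [hτ.1]
        simp only; linarith
      · have h1 : (y - τ) / lam ≤ (P.u 0 + P.u 1 - τ) / lam := by
          apply div_le_div_of_nonneg_right _ l0.le
          have := hy.2
          simp only at this
          linarith
        have h2 : (P.u 0 + P.u 1 - τ) / lam ≤ P.u 0 + P.u 1 - τ := by
          rw [div_le_iff₀ l0]; nlinarith [hτ.2]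
        simp only; linarith
      · rw [E.toralMap_proj]
        congr 1
        simp only at hx
        ext
        · simp [hx]
        · simp only [Prod.mk_add_mk]
          field_simp
          ring

/-- The contraction of the horizontal spine is the action of the toral map on it. -/
theorem toralMap_spine {w : ℤ × ℤ} {τ : ℝ} (hτ : P.latY w = (lam - 1) * τ) (x : ℝ) :
    P.toralMap F (P.proj ((0, -τ) + (x, 0))) =
    P.proj ((0, -τ) + (mu * x + P.latX w, 0)) := by
  rw [E.toralMap_proj, P.proj_eq_iff]
  refine ⟨w, ?_⟩
  ext
  · simp
  · simp [hτ]; ring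

variable {w : ℤ × ℤ} (hw : P.Admissible lam mu w) {τ : ℝ} (hτ : P.latY w = (lam - 1) * τ)
include hw hτ

theorem realizes_iff {σ : Substitution} :
    P.Realizes F (0, -τ) σ ↔ σ = P.subst F mu w := by
  have l0 := E.lam_pos
  -- the image of a vertical segment is a vertical segment between two lattice heights
  have himg : ∀ (c : Fin 2) (x : ℝ),
      P.linMap F '' ((fun q => ((0, -τ) : ℝ × ℝ) + q) '' ({x} ×ˢ Icc 0 (P.u c))) =
        {mu * x} ×ˢ Icc (-τ + P.latY (-w)) (-τ + P.latY (latAct F (latVec c) - w)) := by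
    intro c x
    have e1 : -τ + P.latY (-w) = lam * -τ := by rw [P.latY_neg, hτ]; ring
    have e2 : -τ + P.latY (latAct F (latVec c) - w) = lam * (P.u c - τ) := by
      rw [P.latY_sub, E.latY_act_latVec, hτ]; ring
    rw [e1, e2, image_image]
    ext ⟨a, b⟩
    constructor
    · rintro ⟨⟨x', y⟩, ⟨rfl, hy⟩, he⟩
      beta_reduce at he
      rw [E.linMap_apply] at he
      simp only [Prod.mk_add_mk, Prod.mk.injEq, zero_add] at he hy
      obtain ⟨rfl, rfl⟩ := he
      exact ⟨rfl, mul_le_mul_of_nonneg_left (by linarith [hy.1]) l0.le,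
        mul_le_mul_of_nonneg_left (by linarith [hy.2]) l0.le⟩
    · rintro ⟨ha, hb1, hb2⟩
      simp only [mem_singleton_iff] at ha hb1 hb2
      refine ⟨(x, b / lam + τ), ⟨rfl, ?_, ?_⟩, ?_⟩
      · have : -τ ≤ b / lam := by rw [le_div_iff₀ l0]; linarith
        simp only; linarith
      · have : b / lam ≤ P.u c - τ := by rw [div_le_iff₀ l0]; linarith
        simp only; linarith
      · beta_reduce
        rw [E.linMap_apply, ha]
        simp only [Prod.mk_add_mk, zero_add, Prod.mk.injEq, true_and]
        field_simp
        ring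
  have hle : ∀ c, -τ + P.latY (-w) ≤ -τ + P.latY (latAct F (latVec c) - w) := by
    intro c
    rw [sub_eq_neg_add, P.latY_add, E.latY_act_latVec]
    linarith [mul_pos l0 (P.u_pos c)]
  have hcut : ∀ (c : Fin 2), ∀ x ∈ P.base c, ∀ l : List (Fin 2),
      P.CutInto (0, -τ) (mu * x) (-τ + P.latY (-w)) (-τ + P.latY (latAct F (latVec c) - w)) l ↔
        l = P.subst F mu w c := by
    intro c x hx l
    rw [← E.reads_image_iff hw hx]
    have := cutInto_iff E.latY_injective (v := (0, -τ)) (x := mu * x) (z := -w)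
      (z' := latAct F (latVec c) - w) (w := l)
    simpa only [sub_zero] using this
  constructor
  · intro h
    funext c
    obtain ⟨x, hx⟩ := P.base_nonempty c
    obtain ⟨x', y, y', he, hc⟩ := h c x hx
    rw [himg c x, prod_eq_prod_iff_of_nonempty
        ((singleton_nonempty _).prod (nonempty_Icc.2 (hle c))),
      singleton_eq_singleton_iff, Icc_eq_Icc_iff (hle c)] at he
    obtain ⟨rfl, rfl, rfl⟩ := he
    exact (hcut c x hx _).1 hc
  · rintro rfl c x hx
    exact ⟨_, _, _, himg c x, (hcut c x hx _).2 rfl⟩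

end IsEigen

end BiPartition

namespace BiPartition

variable (P : BiPartition)

/-! ### The principal tilings and the standard substitution -/

theorem word_true_zero : P.word true 0 0 = 0 :=
  word_eq latLen_zero (by simpa using P.s_pos 0)

theorem word_false_zero : P.word false 0 0 = 1 :=
  word_eq latLen_zero (by simpa using P.s_pos 1)

theorem word_true_one : P.word true 0 1 = 1 :=
  word_eq (latLen_latVec 0) (by rw [P.latX_latVec_zero]; simpa using P.s_pos 1)

theorem word_false_one : P.word false 0 1 = 0 :=
  word_eq (latLen_latVec 1) (by rw [P.latX_latVec_one]; simpa using P.s_pos 0)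

theorem word_zero_inj {ε ε' : Bool} (h : P.word ε 0 0 = P.word ε' 0 0) : ε = ε' := by
  cases ε <;> cases ε' <;> simp [P.word_true_zero, P.word_false_zero] at h ⊢

variable {P}

theorem word_latX (ε : Bool) (w : ℤ × ℤ) (n : ℤ) :
    P.word ε (P.latX w) n = P.word ε 0 (n - latLen w) := by
  have := P.word_sub ε 0 (-w) n
  rwa [zero_sub, P.latX_neg, neg_neg, latLen_neg, ← sub_eq_add_neg] at this

theorem factor_word_latX (ε : Bool) (w : ℤ × ℤ) (m : ℤ) (n : ℕ) :
    factor (P.word ε (P.latX w)) m n = factor (P.word ε 0) (m - latLen w) n := by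
  have := factor_word_sub (P := P) ε 0 (-w) m n
  rwa [zero_sub, P.latX_neg, neg_neg, latLen_neg, ← sub_eq_add_neg] at this

namespace IsEigen

variable {F : Matrix (Fin 2) (Fin 2) ℕ} {lam mu : ℝ} (E : P.IsEigen F lam mu)
include E

omit E in
theorem subst_zero_eq (w : ℤ × ℤ) : P.subst F mu w 0 =
    factor (P.word (imageSide mu true) 0) (-latLen w) (F 0 0 + F 1 0) := by
  rw [subst, leftEnd_zero, mul_zero, zero_add, factor_word_latX, zero_sub]

theorem subst_one_eq (w : ℤ × ℤ) : P.subst F mu w 1 =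
    factor (P.word (imageSide mu true) 0) (-latLen w + (F 0 0 + F 1 0 : ℕ)) (F 0 1 + F 1 1) := by
  have e : mu * P.leftEnd 1 + P.latX w = P.latX (w - latAct F (latVec 0)) := by
    rw [leftEnd_one, P.latX_sub, E.latX_act, P.latX_latVec_zero]; ring
  rw [subst, e, factor_word_latX, latLen_sub, latLen_latAct_latVec]
  congr 1
  ring

theorem isStandard_subst : P.IsStandard F (P.subst F mu 0) := by
  have s0 := P.s_pos 0; have s1 := P.s_pos 1
  -- the second word may be read from the right side of its rectangle
  have h1 : P.subst F mu 0 1 = factor (P.word (imageSide mu false) 0) 0 (F 0 1 + F 1 1) := by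
    have := E.factor_word_image E.admissible_zero (c := 1) (ε := false) (x := 0)
      (by simpa using s1)
    simpa using this.symm
  have h0 : P.subst F mu 0 0 = factor (P.word (imageSide mu true) 0) 0 (F 0 0 + F 1 0) := by
    simpa using subst_zero_eq (P := P) (F := F) (mu := mu) 0
  refine ⟨P.word true 0, P.word false 0, .of_word (P.zero_mem_sideSpine _), P.word_true_zero,
    P.word_true_one, .of_word (P.zero_mem_sideSpine _), P.word_false_zero, P.word_false_one,
    fun h => ?_, fun h => ?_⟩
  · have hmu := E.det_eq_one_iff.1 h
    rw [h0, h1, imageSide_of_pos hmu, imageSide_of_pos hmu]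
    exact ⟨rfl, rfl⟩
  · have hmu := E.det_eq_neg_one_iff.1 h
    rw [h0, h1, imageSide_of_neg hmu, imageSide_of_neg hmu]
    exact ⟨rfl, rfl⟩

/-- Unless `w = 0`, the image of the horizontal spine does not cross the vertical spine, so that the
images of all lines are on the same side of it and begin with the same letter. -/
theorem first_letter_unique {w : ℤ × ℤ} (hw : P.Admissible lam mu w) (h0 : 0 < P.latY w)
    {x x' : ℝ} {c c' : Fin 2} (hx : x ∈ Ico (-P.s 1) (P.s 0)) (hx' : x' ∈ Ico (-P.s 1) (P.s 0))
    (hc : mu * x + P.latX w ∈ P.sideBase (imageSide mu true) c)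
    (hc' : mu * x' + P.latX w ∈ P.sideBase (imageSide mu true) c') : c = c' := by
  have s0 := P.s_pos 0; have s1 := P.s_pos 1; have u0 := P.u_pos 0; have u1 := P.u_pos 1
  have l1 := E.one_lt
  have hmu0 := E.mu_ne_zero
  have hne : ∀ y ∈ Ioo (-P.s 1) (P.s 0), mu * y + P.latX w ≠ 0 := by
    intro y hy h
    obtain ⟨v, hvx, hvy⟩ := E.exists_preimage w
    have hv : P.latX v = -y := mul_left_cancel₀ hmu0 (by linarith)
    have hle := hw.le
    refine P.no_latVec_between (v := v) (by linarith [hy.2]) (by linarith [hy.1]) ?_ ?_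
    · by_contra hcon; nlinarith
    · by_contra hcon; nlinarith
  -- otherwise there is a zero between the two points
  have key : ∀ {x x' : ℝ}, x ∈ Ico (-P.s 1) (P.s 0) → x' ∈ Ico (-P.s 1) (P.s 0) →
      mu * x + P.latX w ∈ P.sideBase (imageSide mu true) 0 →
      mu * x' + P.latX w ∈ P.sideBase (imageSide mu true) 1 → False := by
    intro x x' hx hx' hc hc'
    obtain ⟨y, hy⟩ : ∃ y, mu * y + P.latX w = 0 :=
      ⟨-P.latX w / mu, by rw [mul_div_cancel₀ _ hmu0]; ring⟩
    refine hne y ?_ hy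
    rcases lt_or_gt_of_ne hmu0 with hmu | hmu
    · rw [imageSide_of_neg hmu] at hc hc'
      simp at hc hc'
      have h1 : x < y := by by_contra hcon; nlinarith [hc.1]
      have h2 : y ≤ x' := by by_contra hcon; nlinarith [hc'.2]
      exact ⟨by linarith [hx.1], by linarith [hx'.2]⟩
    · rw [imageSide_of_pos hmu] at hc hc'
      simp at hc hc'
      have h1 : x' < y := by by_contra hcon; nlinarith [hc'.2]
      have h2 : y ≤ x := by by_contra hcon; nlinarith [hc.1]
      exact ⟨by linarith [hx'.1], by linarith [hx.2]⟩
  obtain rfl | rfl := fin_two_eq_zero_or_one c <;>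
    obtain rfl | rfl := fin_two_eq_zero_or_one c'
  · rfl
  · exact (key hx hx' hc hc').elim
  · exact (key hx' hx hc' hc).elim
  · rfl

/-- The words of both letters begin with the same letter, and so does the word that follows them.
These are the letters that a shift of the window by one place takes in and gives away. -/
theorem principal_periodic {w : ℤ × ℤ} (hw : P.Admissible lam mu w) (h0 : 0 < P.latY w) :
    P.word (imageSide mu true) 0 (-latLen w) =
        P.word (imageSide mu true) 0 (-latLen w + (F 0 0 + F 1 0 : ℕ)) ∧
      P.word (imageSide mu true) 0 (-latLen w + (F 0 0 + F 1 0 : ℕ)) =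
        P.word (imageSide mu true) 0 (-latLen w + (F 0 0 + F 1 0 : ℕ) + (F 0 1 + F 1 1 : ℕ)) := by
  have s0 := P.s_pos 0; have s1 := P.s_pos 1
  have key : ∀ q : ℤ × ℤ, mu * -P.latX q + P.latX w ∈ P.sideSpine (imageSide mu true) →
      mu * -P.latX q + P.latX w ∈ P.sideBase (imageSide mu true)
        (P.word (imageSide mu true) 0 (-latLen w + latLen (latAct F q))) := by
    intro q hq
    have e : 0 - P.latX (-w + latAct F q) = mu * -P.latX q + P.latX w := by
      rw [P.latX_add, E.latX_act, P.latX_neg]; ring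
    have h := P.sub_corner_mem_sideBase (imageSide mu true) 0 (-latLen w + latLen (latAct F q))
    rwa [corner_eq (z := -w + latAct F q) (by rw [latLen_add, latLen_neg]) (by rwa [e]), e] at h
  have hs : ∀ x ∈ Ico (-P.s 1) (P.s 0), mu * x + P.latX w ∈ P.sideSpine (imageSide mu true) :=
    fun x hx => hw.maps_sideSpine E.mu_ne_zero (ε := true) hx
  have m0 : -P.latX 0 ∈ Ico (-P.s 1) (P.s 0) := by simpa using ⟨s1.le, s0⟩
  have m1 : -P.latX (latVec 0) ∈ Ico (-P.s 1) (P.s 0) := by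
    rw [P.latX_latVec_zero]; exact ⟨le_rfl, by linarith⟩
  have m2 : -P.latX (latVec 0 + latVec 1) ∈ Ico (-P.s 1) (P.s 0) := by
    rw [P.latX_add, P.latX_latVec_zero, P.latX_latVec_one]; constructor <;> linarith
  have k0 := key 0 (hs _ m0)
  have k1 := key _ (hs _ m1)
  have k2 := key _ (hs _ m2)
  rw [latAct_zero, latLen_zero, add_zero] at k0
  rw [latLen_latAct_latVec] at k1
  rw [latAct_add, latLen_add, latLen_latAct_latVec, latLen_latAct_latVec, ← add_assoc] at k2
  exact ⟨E.first_letter_unique hw h0 m0 m1 k0 k1, E.first_letter_unique hw h0 m1 m2 k1 k2⟩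

/-- The words of the `i`-th admissible position are `i` rotations away from those of the lowest
position. -/
theorem rotate_subst {i : ℕ} (hi : i < F 0 0 + F 0 1 + F 1 0 + F 1 1 - 1) (c : Fin 2) :
    (P.subst F mu (-P.corner true 0 (-i)) c).rotate i = P.subst F mu 0 c := by
  have hlen : ∀ j : ℕ, latLen (-P.corner true 0 (-j)) = j := fun j => by
    rw [latLen_neg, P.latLen_corner, neg_neg]
  have hper := fun (j : ℕ) (h1 : 1 ≤ j) (h2 : j ≤ i) => by
    have h := (E.admissible_neg_corner_iff j).2 ⟨by omega, by omega⟩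
    refine E.principal_periodic h ?_
    have hlt := latY_corner_strictMono (P := P) true 0 (a := -j) (b := 0) (by omega)
    beta_reduce at hlt
    rw [corner_zero (P.zero_mem_sideSpine true), P.latY_zero] at hlt
    rw [P.latY_neg]
    linarith
  simp only [hlen] at hper
  obtain rfl | rfl := fin_two_eq_zero_or_one c
  · rw [subst_zero_eq, subst_zero_eq, hlen, latLen_zero, neg_zero, ← add_zero (-(i : ℤ))]
    refine rotate_factor _ _ _ _ fun j h1 h2 => ?_
    rw [add_zero]
    exact (hper j h1 h2).1
  · rw [E.subst_one_eq, E.subst_one_eq, hlen, latLen_zero, neg_zero, zero_add]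
    exact rotate_factor _ _ _ _ fun j h1 h2 => (hper j h1 h2).2

end IsEigen

end BiPartition

/-! ### Density of the orbits -/

theorem latLen_zsmul (m : ℤ) (z : ℤ × ℤ) : latLen (m • z) = m * latLen z := by
  simp only [latLen, Prod.smul_fst, Prod.smul_snd, smul_eq_mul]; ring

namespace Substitution

variable {σ : Substitution} {ω : ℤ → Fin 2} {N : ℤ → ℤ}

/-- The concatenation of nonempty words covers the right half of the line. -/
theorem exists_index (hσ : ∀ c, 0 < (σ c).length) (h0 : N 0 = 0)
    (hN : ∀ n, 0 ≤ n → N (n + 1) = N n + (σ (ω n)).length) (m : ℕ) :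
    ∃ n k : ℕ, k < (σ (ω n)).length ∧ (m : ℤ) = N n + k := by
  induction m with
  | zero => exact ⟨0, 0, hσ _, by simp [h0]⟩
  | succ m ih =>
    obtain ⟨n, k, hk, hm⟩ := ih
    by_cases hlt : k + 1 < (σ (ω n)).length
    · exact ⟨n, k + 1, hlt, by push_cast; omega⟩
    · refine ⟨n + 1, 0, hσ _, ?_⟩
      have := hN n (by omega)
      push_cast
      rw [this]
      omega

/-- The right image of a word is determined. -/
theorem IsRightImage.unique {ω' ω'' : ℤ → Fin 2} (hσ : ∀ c, 0 < (σ c).length)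
    (h' : σ.IsRightImage ω ω') (h'' : σ.IsRightImage ω ω'') (m : ℕ) : ω' m = ω'' m := by
  obtain ⟨N, h0, hN⟩ := h'
  obtain ⟨N', h0', hN'⟩ := h''
  have e : ∀ n : ℕ, N n = N' n := by
    intro n
    induction n with
    | zero => simp [h0, h0']
    | succ n ih => push_cast; rw [(hN n (by omega)).1, (hN' n (by omega)).1, ih]
  obtain ⟨n, k, hk, hm⟩ := exists_index hσ h0 (fun n hn => (hN n hn).1) m
  have h1 := (hN n (by omega)).2
  have h2 := (hN' n (by omega)).2
  rw [hm, eq_of_factor_eq (h1.trans h2.symm) hk, e]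

end Substitution

theorem length_eq_count_add_count (l : List (Fin 2)) : l.length = l.count 0 + l.count 1 := by
  induction l with
  | nil => rfl
  | cons c l ih => obtain rfl | rfl := fin_two_eq_zero_or_one c <;> simp [ih] <;> ring

namespace BiPartition

variable {P : BiPartition}

theorem latX_zsmul (m : ℤ) (z : ℤ × ℤ) : P.latX (m • z) = m * P.latX z := by
  simp only [latX, Prod.smul_fst, Prod.smul_snd, smul_eq_mul]; push_cast; ring

namespace IsEigen

variable {F : Matrix (Fin 2) (Fin 2) ℕ} {lam mu : ℝ} (E : P.IsEigen F lam mu)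
include E

/-- The iterates of a lattice vector come arbitrarily close to the vertical axis. -/
theorem exists_small_latX {η : ℝ} (hη : 0 < η) :
    ∃ q : ℤ × ℤ, 0 ≤ latLen q ∧ P.latX q ≠ 0 ∧ |P.latX q| < η := by
  have s1 := P.s_pos 1
  have key : ∀ n : ℕ, ∃ q : ℤ × ℤ, 0 ≤ q.1 ∧ 0 ≤ q.2 ∧ P.latX q = mu ^ n * P.s 1 := by
    intro n
    induction n with
    | zero => exact ⟨latVec 0, by simp, by simp, by rw [P.latX_latVec_zero]; simp⟩
    | succ n ih =>
      obtain ⟨q, h1, h2, h3⟩ := ih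
      exact ⟨latAct F q, by simp only [latAct]; positivity, by simp only [latAct]; positivity,
        by rw [E.latX_act, h3]; ring⟩
  obtain ⟨n, hn⟩ := exists_pow_lt_of_lt_one (div_pos hη s1) E.abs_mu_lt_one
  obtain ⟨q, h1, h2, h3⟩ := key n
  refine ⟨q, add_nonneg h1 h2, ?_, ?_⟩
  · rw [h3]; exact mul_ne_zero (pow_ne_zero _ E.mu_ne_zero) s1.ne'
  · rw [h3, abs_mul, abs_pow, abs_of_pos s1]
    rwa [lt_div_iff₀ s1] at hn

/-- Every forward orbit visits every open subset of the spine. -/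
theorem exists_corner_mem (ε : Bool) (y : ℝ) {U : Set ℝ} (hU : IsOpen U) (hne : U.Nonempty)
    (hsub : U ⊆ Ioo (-P.s 1) (P.s 0)) : ∃ n : ℕ, y - P.latX (P.corner ε y n) ∈ U := by
  have s0 := P.s_pos 0; have s1 := P.s_pos 1
  suffices ∃ z : ℤ × ℤ, 0 ≤ latLen z ∧ y - P.latX z ∈ U by
    obtain ⟨z, hz, hzU⟩ := this
    obtain ⟨n, hn⟩ := Int.eq_ofNat_of_zero_le hz
    refine ⟨n, ?_⟩
    rwa [corner_eq hn (P.Ioo_subset_sideSpine ε (hsub hzU))]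
  obtain ⟨x, hx⟩ := hne
  obtain ⟨α, β, ⟨hα, hβ⟩, hαβ⟩ := mem_nhds_iff_exists_Ioo_subset.1 (hU.mem_nhds hx)
  obtain ⟨q, hq, hq0, hqlt⟩ := E.exists_small_latX (η := β - α) (by linarith)
  -- start far away, on the side from which the multiples of `q` move towards `U`
  rcases lt_or_gt_of_ne hq0 with hneg | hpos
  · rw [abs_of_neg hneg] at hqlt
    obtain ⟨A, hA⟩ := exists_nat_gt ((y - α) / P.s 1)
    rw [div_lt_iff₀ s1] at hA
    obtain ⟨m, ⟨hm1, hm2⟩, -⟩ := existsUnique_add_zsmul_mem_Ico (neg_pos.2 hneg)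
      (y - P.s 1 * A) ((α + β + P.latX q) / 2)
    rw [zsmul_eq_mul] at hm1 hm2
    have hm : 0 ≤ m := by
      have : (0 : ℝ) ≤ m := by by_contra hcon; nlinarith
      exact_mod_cast this
    refine ⟨((A : ℤ), 0) + m • q, ?_, hαβ ?_⟩
    · rw [latLen_add, latLen_zsmul]
      have : latLen ((A : ℤ), 0) = A := by simp [latLen]
      rw [this]; positivity
    · have : P.latX ((A : ℤ), 0) = P.s 1 * A := by simp [latX]
      rw [P.latX_add, latX_zsmul, this]
      constructor <;> linarith
  · rw [abs_of_pos hpos] at hqlt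
    obtain ⟨B, hB⟩ := exists_nat_gt ((β - y) / P.s 0)
    rw [div_lt_iff₀ s0] at hB
    obtain ⟨m, ⟨hm1, hm2⟩, -⟩ := existsUnique_add_zsmul_mem_Ico hpos
      (y + P.s 0 * B) ((α + β - P.latX q) / 2)
    rw [zsmul_eq_mul] at hm1 hm2
    have hm : 0 ≤ -m := by
      have : (0 : ℝ) ≤ -m := by by_contra hcon; nlinarith
      exact_mod_cast this
    refine ⟨(0, (B : ℤ)) + (-m) • q, ?_, hαβ ?_⟩
    · rw [latLen_add, latLen_zsmul]
      have : latLen (0, (B : ℤ)) = B := by simp [latLen]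
      rw [this]; positivity
    · have : P.latX (0, (B : ℤ)) = -(P.s 0 * B) := by simp [latX]
      rw [P.latX_add, latX_zsmul, this]
      push_cast
      constructor <;> linarith

/-- The right half of a word determines its line. -/
theorem eq_of_word_eq {ε : Bool} {y y' : ℝ} (hy : y ∈ P.sideSpine ε) (hy' : y' ∈ P.sideSpine ε)
    (h : ∀ m : ℕ, P.word ε y m = P.word ε y' m) : y = y' := by
  have s0 := P.s_pos 0; have s1 := P.s_pos 1
  suffices ∀ {y y' : ℝ}, y ∈ P.sideSpine ε → y' ∈ P.sideSpine ε →
      (∀ m : ℕ, P.word ε y m = P.word ε y' m) → y ≤ y' from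
    le_antisymm (this hy hy' h) (this hy' hy fun m => (h m).symm)
  intro y y' hy hy' h
  have hc : ∀ m : ℕ, P.corner ε y m = P.corner ε y' m := by
    intro m
    induction m with
    | zero => simp only [Nat.cast_zero]; rw [corner_zero hy, corner_zero hy']
    | succ m ih => push_cast; rw [corner_succ, corner_succ, ih, h]
  by_contra hlt
  rw [not_le] at hlt
  -- a point of the first orbit that is positive, but less than `y - y'`
  obtain ⟨m, hm1, hm2⟩ := E.exists_corner_mem ε y (U := Ioo 0 (min (y - y') (P.s 0))) isOpen_Ioo
    (nonempty_Ioo.2 (lt_min (by linarith) s0))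
    (Ioo_subset_Ioo (by linarith) (min_le_right _ _))
  have hm3 := lt_min_iff.1 hm2
  have h1 := P.sub_corner_mem_sideBase ε y m
  have h2 := P.sub_corner_mem_sideBase ε y' m
  have h3 := P.sideBase_subset_closedBase _ _ h1
  have h4 := P.sideBase_subset_closedBase _ _ h2
  rw [← h, ← hc] at h4
  obtain e | e := fin_two_eq_zero_or_one (P.word ε y m) <;> rw [e] at h3 h4
  · linarith [h4.1, hm3.1]
  · linarith [h3.2]

theorem subst_injective {w w' : ℤ × ℤ} (hw : P.Admissible lam mu w)
    (hw' : P.Admissible lam mu w') (h : P.subst F mu w = P.subst F mu w') : w = w' := by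
  apply E.latX_injective
  have h0 := P.zero_mem_sideSpine true
  have i1 := (E.subst_isImage hw h0).isRightImage
  have i2 := (E.subst_isImage hw' h0).isRightImage
  have k1 := hw.maps_sideSpine E.mu_ne_zero h0
  have k2 := hw'.maps_sideSpine E.mu_ne_zero h0
  rw [mul_zero, zero_add] at i1 i2 k1 k2
  rw [← h] at i2
  refine E.eq_of_word_eq k1 k2 (i1.unique (fun c => ?_) i2)
  rw [P.length_subst]
  exact E.column_pos c

/-! ### Substitutions that preserve a Sturmian word -/

/-- Every substitution with the matrix `F` that maps a tiling to a tiling is one of the `subst`.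
The right image moves the orbit of the line by an affine contraction of the spine. Since the orbit
of the image is dense, the image intervals of the bases cover the spine; each lies on one side of
`0`, so that `0` is an end of one of them, and the contraction is given by a lattice point. -/
theorem exists_eq_subst {σ : Substitution} (hσ : σ.HasMatrix F) {ε ε' : Bool} {y y' : ℝ}
    (h : σ.IsRightImage (P.word ε y) (P.word ε' y')) (hy : y ∈ P.sideSpine ε)
    (hy' : y' ∈ P.sideSpine ε') :
    ∃ w, P.Admissible lam mu w ∧ σ = P.subst F mu w := by
  have s0 := P.s_pos 0; have s1 := P.s_pos 1; have u0 := P.u_pos 0; have u1 := P.u_pos 1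
  have l1 := E.one_lt
  have hmu0 := E.mu_ne_zero
  obtain ⟨N, N0, hN⟩ := h
  have hlen : ∀ c, (σ c).length = F 0 c + F 1 c := fun c => by
    rw [length_eq_count_add_count, hσ, hσ]
  have hpos : ∀ c, 0 < (σ c).length := fun c => by rw [hlen]; exact E.column_pos c
  have hcorner : ∀ n : ℕ, P.corner ε' y' (N n) = latAct F (P.corner ε y n) := by
    intro n
    induction n with
    | zero => simp only [Nat.cast_zero]; rw [N0, corner_zero hy, corner_zero hy', latAct_zero]
    | succ n ih =>
      have h1 := hN n (by omega)
      push_cast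
      rw [h1.1, corner_add, h1.2, hσ, hσ, ih, corner_succ, latAct_add, latAct_latVec]
  set κ : ℝ := y' - mu * y with hκ
  -- the lattice vector from the lower end of the image of a segment to its `k`-th tile
  set q : Fin 2 → ℕ → ℤ × ℤ := fun c k =>
    ((((σ c).take k).count 0 : ℤ), (((σ c).take k).count 1 : ℤ)) with hq
  have horbit : ∀ (n k : ℕ), k < (σ (P.word ε y n)).length →
      y' - P.latX (P.corner ε' y' (N n + k)) =
        mu * (y - P.latX (P.corner ε y n)) + κ - P.latX (q (P.word ε y n) k) := by
    intro n k hk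
    have h1 := (hN n (by omega)).2
    have h2 : factor (P.word ε' y') (N n) k = (σ (P.word ε y n)).take k := by
      rw [← h1, take_factor _ _ hk.le]
    rw [corner_add, h2, hcorner, P.latX_add, E.latX_act, hκ]
    ring
  have htile : ∀ (c : Fin 2) (k : ℕ) (hk : k < (σ c).length), ∀ x ∈ P.closedBase c,
      mu * x + κ - P.latX (q c k) ∈ P.closedBase ((σ c)[k]) := by
    intro c k hk
    have hclosed : IsClosed {x | mu * x + κ - P.latX (q c k) ∈ P.closedBase ((σ c)[k])} := by
      refine IsClosed.preimage (by fun_prop) ?_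
      obtain e | e := fin_two_eq_zero_or_one ((σ c)[k]) <;> rw [e] <;> exact isClosed_Icc
    have hbase : P.base c ⊆ {x | mu * x + κ - P.latX (q c k) ∈ P.closedBase ((σ c)[k])} := by
      intro x hx
      by_contra hcon
      have hopen : IsOpen (P.base c) := by
        obtain rfl | rfl := fin_two_eq_zero_or_one c <;> exact isOpen_Ioo
      have hsub : P.base c ⊆ Ioo (-P.s 1) (P.s 0) := by
        obtain rfl | rfl := fin_two_eq_zero_or_one c
        · exact Ioo_subset_Ioo (by linarith) le_rfl
        · exact Ioo_subset_Ioo le_rfl s0.le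
      obtain ⟨n, hn1, hn2⟩ := E.exists_corner_mem ε y (hopen.inter hclosed.isOpen_compl)
        ⟨x, hx, hcon⟩ (inter_subset_left.trans hsub)
      have hword : P.word ε y n = c :=
        P.sideBase_unique (P.sub_corner_mem_sideBase ε y n) (P.base_subset_sideBase ε c hn1)
      subst hword
      refine hn2 ?_
      change _ ∈ P.closedBase ((σ (P.word ε y n))[k])
      rw [← horbit n k hk]
      have h1 := (hN n (by omega)).2
      have h2 : P.word ε' y' (N n + k) = (σ (P.word ε y n))[k] := by
        rw [← getElem_factor (P.word ε' y') (N n) _ k (by rw [h1]; exact hk)]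
        simp only [h1]
      rw [← h2]
      exact P.sideBase_subset_closedBase _ _ (P.sub_corner_mem_sideBase ε' y' _)
    have hcl : P.closedBase c = closure (P.base c) := by
      obtain rfl | rfl := fin_two_eq_zero_or_one c
      · exact (closure_Ioo s0.ne).symm
      · exact (closure_Ioo (by linarith : -P.s 1 < 0).ne).symm
    rw [hcl]
    exact fun x hx => closure_minimal hbase hclosed hx
  have hmaps : ∀ x ∈ Icc (-P.s 1) (P.s 0), mu * x + κ ∈ Icc (-P.s 1) (P.s 0) := by
    intro x hx
    obtain ⟨c, hc⟩ : ∃ c, x ∈ P.closedBase c := by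
      rcases le_total 0 x with h | h
      · exact ⟨0, h, hx.2⟩
      · exact ⟨1, hx.1, h⟩
    have := P.closedBase_subset _ (htile c 0 (hpos c) x hc)
    have hq0 : q c 0 = 0 := by simp [hq]
    rwa [hq0, P.latX_zero, sub_zero] at this
  -- the images of the bases cover the spine
  obtain ⟨c, k, hk, x₀, hx₀, hzero⟩ : ∃ c k, k < (σ c).length ∧ ∃ x ∈ P.closedBase c,
      mu * x + κ - P.latX (q c k) = 0 := by
    set T : Set ℝ := ⋃ c, ⋃ k : Fin (σ c).length,
      (fun x => mu * x + κ - P.latX (q c k)) '' P.closedBase c with hT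
    have hTc : IsClosed T := by
      refine isClosed_iUnion_of_finite fun c => isClosed_iUnion_of_finite fun k => ?_
      refine (IsCompact.image ?_ (by fun_prop)).isClosed
      obtain rfl | rfl := fin_two_eq_zero_or_one c <;> exact isCompact_Icc
    have h0T : (0 : ℝ) ∈ T := by
      by_contra hcon
      obtain ⟨m, hm1, hm2⟩ := E.exists_corner_mem ε' y' (hTc.isOpen_compl.inter isOpen_Ioo)
        ⟨0, hcon, by linarith, s0⟩ inter_subset_right
      obtain ⟨n, k, hk, hm⟩ := Substitution.exists_index hpos N0 (fun n hn => (hN n hn).1) m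
      refine hm1 ?_
      rw [hm, horbit n k hk]
      exact mem_iUnion.2 ⟨_, mem_iUnion.2 ⟨⟨k, hk⟩, _, P.sideBase_subset_closedBase _ _
        (P.sub_corner_mem_sideBase ε y n), rfl⟩⟩
    obtain ⟨c, hc⟩ := mem_iUnion.1 h0T
    obtain ⟨k, x, hx, hx0⟩ := mem_iUnion.1 hc
    exact ⟨c, k, k.2, x, hx, hx0⟩
  -- the zero is attained at an end of the base, which is the abscissa of a lattice vector
  obtain ⟨v, hvx, hv0, hv1⟩ : ∃ v : ℤ × ℤ, x₀ = -P.latX v ∧ 0 ≤ P.latY v ∧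
      P.latY v + P.u c ≤ P.u 0 + P.u 1 := by
    have hend : x₀ ∉ P.base c := by
      intro hx
      have hsign : ∀ a b : ℝ, a ∈ P.closedBase ((σ c)[k]) → b ∈ P.closedBase ((σ c)[k]) →
          0 ≤ a * b := by
        intro a b ha hb
        obtain e | e := fin_two_eq_zero_or_one ((σ c)[k]) <;> rw [e] at ha hb
        · exact mul_nonneg ha.1 hb.1
        · exact mul_nonneg_of_nonpos_of_nonpos ha.2 hb.2
      have hmu2 : 0 < mu ^ 2 := by positivity
      have hends : ∀ a b : ℝ, a ∈ P.closedBase c → b ∈ P.closedBase c → a < x₀ → x₀ < b →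
          False := by
        intro a b ha hb h1 h2
        have := hsign _ _ (htile c k hk a ha) (htile c k hk b hb)
        have ea : mu * a + κ - P.latX (q c k) = mu * (a - x₀) := by linarith
        have eb : mu * b + κ - P.latX (q c k) = mu * (b - x₀) := by linarith
        rw [ea, eb] at this
        nlinarith [mul_pos hmu2 (mul_pos (sub_pos.2 h1) (sub_pos.2 h2))]
      obtain rfl | rfl := fin_two_eq_zero_or_one c
      · exact hends 0 (P.s 0) ⟨le_rfl, s0.le⟩ ⟨s0.le, le_rfl⟩ hx.1 hx.2
      · exact hends (-P.s 1) 0 ⟨le_rfl, by linarith⟩ ⟨by linarith, le_rfl⟩ hx.1 hx.2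
    obtain rfl | rfl := fin_two_eq_zero_or_one c
    · rcases hx₀.1.eq_or_lt with h | h
      · exact ⟨0, by simp [← h], by simp, by simp; linarith⟩
      · refine ⟨latVec 1, ?_, by rw [P.latY_latVec]; linarith, by rw [P.latY_latVec]; linarith⟩
        rw [P.latX_latVec_one, neg_neg]
        exact hx₀.2.eq_or_lt.resolve_right fun h' => hend ⟨h, h'⟩
    · rcases hx₀.2.eq_or_lt with h | h
      · exact ⟨0, by simp [h], by simp, by simp; linarith⟩
      · refine ⟨latVec 0, ?_, by rw [P.latY_latVec]; linarith, by rw [P.latY_latVec]⟩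
        rw [P.latX_latVec_zero]
        exact (hx₀.1.eq_or_lt.resolve_right fun h' => hend ⟨h', h⟩).symm
  have hq0 : 0 ≤ P.latY (q c k) := by
    simp only [hq, latY]; positivity
  have hqlt : P.latY (q c k) < lam * P.u c := by
    rw [← E.latY_act_latVec, latAct_latVec]
    have a0 : ((σ c).take k).count 0 ≤ F 0 c := by
      rw [← hσ]; exact (List.take_sublist _ _).count_le _
    have a1 : ((σ c).take k).count 1 ≤ F 1 c := by
      rw [← hσ]; exact (List.take_sublist _ _).count_le _
    have a2 : ((σ c).take k).count 0 + ((σ c).take k).count 1 < F 0 c + F 1 c := by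
      rw [← length_eq_count_add_count, List.length_take, ← hlen]; omega
    simp only [hq, latY, Int.cast_natCast]
    have b0 : (((σ c).take k).count 0 : ℝ) ≤ F 0 c := by exact_mod_cast a0
    have b1 : (((σ c).take k).count 1 : ℝ) ≤ F 1 c := by exact_mod_cast a1
    rcases a0.lt_or_eq with h | h
    · have : (((σ c).take k).count 0 : ℝ) < F 0 c := by exact_mod_cast h
      nlinarith
    · have : (((σ c).take k).count 1 : ℝ) < F 1 c := by exact_mod_cast (by omega)
      nlinarith
  have hwX : P.latX (q c k + latAct F v) = κ := by
    rw [P.latX_add, E.latX_act]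
    rw [hvx] at hzero
    linarith
  have hwY : P.latY (q c k + latAct F v) = P.latY (q c k) + lam * P.latY v := by
    rw [P.latY_add, E.latY_act]
  have hw : P.Admissible lam mu (q c k + latAct F v) := by
    refine ⟨?_, ?_, by rwa [hwX]⟩
    · rw [hwY]; exact add_nonneg hq0 (mul_nonneg (by linarith) hv0)
    · -- otherwise the difference to the image of the other end of the fundamental domain is too
      -- short for a lattice vector
      by_contra hcon
      rw [not_le] at hcon
      have e1 : P.latX (latAct F (latVec 0 + latVec 1)) = mu * (P.s 1 - P.s 0) := by
        rw [E.latX_act, P.latX_add, P.latX_latVec_zero, P.latX_latVec_one]; ring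
      have e2 : P.latY (latAct F (latVec 0 + latVec 1)) = lam * (P.u 0 + P.u 1) := by
        rw [E.latY_act, P.latY_add, P.latY_latVec, P.latY_latVec]
      have hadm : mu * (P.s 0 - P.s 1) + κ ∈ Ioo (-P.s 1) (P.s 0) := by
        have h1 := hmaps (-P.s 1) ⟨le_rfl, by linarith⟩
        have h2 := hmaps (P.s 0) ⟨by linarith, le_rfl⟩
        rcases lt_or_gt_of_ne hmu0 with hmu | hmu <;> constructor <;>
          nlinarith [h1.1, h1.2, h2.1, h2.2]
      refine P.no_latVec_between
        (v := latAct F (latVec 0 + latVec 1) - (q c k + latAct F v)) ?_ ?_ ?_ ?_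
      · rw [P.latX_sub, e1, hwX]; linarith [hadm.2]
      · rw [P.latX_sub, e1, hwX]; linarith [hadm.1]
      · rw [P.latY_sub, e2, hwY]; nlinarith
      · rw [P.latY_sub, e2]; linarith
  refine ⟨_, hw, funext fun c => ?_⟩
  obtain ⟨n, hn⟩ : ∃ n : ℕ, y - P.latX (P.corner ε y n) ∈ P.base c := by
    refine E.exists_corner_mem ε y ?_ (P.base_nonempty c) ?_
    · obtain rfl | rfl := fin_two_eq_zero_or_one c <;> exact isOpen_Ioo
    · obtain rfl | rfl := fin_two_eq_zero_or_one c
      · exact Ioo_subset_Ioo (by linarith) le_rfl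
      · exact Ioo_subset_Ioo le_rfl s0.le
  have hword : P.word ε y n = c :=
    P.sideBase_unique (P.sub_corner_mem_sideBase ε y n) (P.base_subset_sideBase ε c hn)
  have h1 := (hN n (by omega)).2
  rw [hword, hlen] at h1
  have h2 := E.factor_word_image hw (P.base_subset_sideBase (imageSide mu ε') c hn)
  rw [imageSide_imageSide, hwX] at h2
  have e : mu * (y - P.latX (P.corner ε y n)) + κ =
      y' - P.latX (latAct F (P.corner ε y n)) := by rw [E.latX_act, hκ]; ring
  rw [e, factor_word_sub, zero_add, ← hcorner, P.latLen_corner, h1] at h2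
  exact h2

end IsEigen

end BiPartition

/-! ### The connectivity matrix -/

theorem count_factor (ω : ℤ → Fin 2) (m : ℤ) (n : ℕ) (c : Fin 2) :
    (factor ω m n).count c = ((Finset.range n).filter fun k : ℕ => ω (m + k) = c).card := by
  induction n with
  | zero => rfl
  | succ n ih =>
    rw [factor_succ_last, List.count_append, ih, Finset.range_add_one, Finset.filter_insert]
    split_ifs with h
    · rw [Finset.card_insert_of_notMem (by simp), h]; simp
    · simp [h]

/-- A disjoint union of nonempty connected open sets has these sets as its components. -/
theorem card_connectedComponents_of_iUnion {X ι : Type*} [TopologicalSpace X] {S : Set X}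
    (V : ι → Set X) (hS : S = ⋃ i, V i) (hopen : ∀ i, IsOpen (V i))
    (hconn : ∀ i, IsPreconnected (V i)) (hne : ∀ i, (V i).Nonempty)
    (hdisj : ∀ i j, (V i ∩ V j).Nonempty → i = j) :
    ENat.card (ConnectedComponents S) = ENat.card ι := by
  have hsub : ∀ i, V i ⊆ S := fun i => hS ▸ subset_iUnion V i
  choose x hx using hne
  let U : ι → Set S := fun i => Subtype.val ⁻¹' V i
  have hUo : ∀ i, IsOpen (U i) := fun i => (hopen i).preimage continuous_subtype_val
  have hUc : ∀ i, IsPreconnected (U i) := fun i => by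
    rw [← Topology.IsInducing.subtypeVal.isPreconnected_image, Subtype.image_preimage_coe,
      inter_eq_right.2 (hsub i)]
    exact hconn i
  have hcover : ∀ a : S, ∃ i, a ∈ U i := fun a => by
    obtain ⟨i, hi⟩ := mem_iUnion.1 (hS.subset a.2)
    exact ⟨i, hi⟩
  have hclopen : ∀ i, IsClopen (U i) := fun i => by
    refine ⟨⟨?_⟩, hUo i⟩
    have : (U i)ᶜ = ⋃ j : {j // j ≠ i}, U j := by
      ext a
      simp only [mem_compl_iff, mem_iUnion, Subtype.exists, exists_prop]
      constructor
      · intro h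
        obtain ⟨j, hj⟩ := hcover a
        exact ⟨j, by rintro rfl; exact h hj, hj⟩
      · rintro ⟨j, hji, hj⟩ hi
        exact hji (hdisj j i ⟨a, hj, hi⟩)
    rw [this]
    exact isOpen_iUnion fun j => hUo j
  let f : ι → ConnectedComponents S := fun i => ((⟨x i, hsub i (hx i)⟩ : S) :)
  refine (ENat.card_congr (Equiv.ofBijective f ⟨fun i j h => ?_, fun a => ?_⟩)).symm
  · have h1 := ConnectedComponents.coe_eq_coe'.1 h
    have h2 := (hclopen j).connectedComponent_subset (x := ⟨x j, hsub j (hx j)⟩) (hx j) h1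
    exact hdisj i j ⟨x i, hx i, h2⟩
  · obtain ⟨a, rfl⟩ := ConnectedComponents.surjective_coe a
    obtain ⟨i, hi⟩ := hcover a
    exact ⟨i, ConnectedComponents.coe_eq_coe'.2
      ((hUc i).subset_connectedComponent hi (hx i))⟩

namespace BiPartition

variable (P : BiPartition)

theorem interior_rect (c : Fin 2) : interior (P.rect c) = P.base c ×ˢ Ioo 0 (P.u c) := by
  rw [rect_eq, interior_prod_eq, interior_Icc]
  obtain rfl | rfl := fin_two_eq_zero_or_one c <;> simp [interior_Icc]

theorem isOpen_base (c : Fin 2) : IsOpen (P.base c) := by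
  obtain rfl | rfl := fin_two_eq_zero_or_one c <;> exact isOpen_Ioo

theorem isPreconnected_base (c : Fin 2) : IsPreconnected (P.base c) := by
  obtain rfl | rfl := fin_two_eq_zero_or_one c <;> exact isPreconnected_Ioo

/-- No nonzero lattice vector joins two points of the interior of a rectangle; hence the interiors
of the rectangles embed into the torus. -/
theorem latVec_eq_zero_of_base {v : ℤ × ℤ} {c : Fin 2} {x x' : ℝ} (hx : x ∈ P.base c)
    (hx' : x' ∈ P.base c) (hv : P.latX v = x' - x) (h1 : -P.u c < P.latY v)
    (h2 : P.latY v < P.u c) : v = 0 := by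
  obtain ⟨A, B⟩ := v
  have s0 := P.s_pos 0; have s1 := P.s_pos 1; have u0 := P.u_pos 0; have u1 := P.u_pos 1
  have key : ∀ n : ℤ, (n : ℝ) ≤ -1 ∨ n = 0 ∨ 1 ≤ (n : ℝ) := by
    intro n
    rcases lt_trichotomy n 0 with h | h | h
    · left; exact_mod_cast (by omega : n ≤ -1)
    · right; left; exact h
    · right; right; exact_mod_cast (by omega : 1 ≤ n)
  obtain rfl | rfl := fin_two_eq_zero_or_one c <;> simp [latX, latY] at hx hx' hv h1 h2 <;>
    obtain ⟨hx1, hx2⟩ := hx <;> obtain ⟨hx1', hx2'⟩ := hx' <;>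
    rcases key A with hA | hA | hA <;> rcases key B with hB | hB | hB <;>
    first
    | (subst hA hB; rfl)
    | (exfalso; subst hA; simp at hv h1 h2; nlinarith)
    | (exfalso; subst hB; simp at hv h1 h2; nlinarith)
    | (exfalso; nlinarith)

variable {P}

namespace IsEigen

variable {F : Matrix (Fin 2) (Fin 2) ℕ} {lam mu : ℝ} (E : P.IsEigen F lam mu)
  {w : ℤ × ℤ} (hw : P.Admissible lam mu w) {τ : ℝ} (hτ : P.latY w = (lam - 1) * τ)
include E hw hτ

/-- The image of the rectangle `i` meets the rectangle `j` in one open strip for every letter `j` of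
the word of `i`, and the number of these letters is prescribed by the matrix. -/
theorem hasConnectivityMatrix : P.HasConnectivityMatrix F (0, -τ) Fᵀ := by
  intro i j
  have l0 := E.lam_pos
  have hmu0 := E.mu_ne_zero
  set δ := imageSide mu true with hδ
  set ω := P.word δ (mu * P.leftEnd i + P.latX w) with hω
  set ζ : ℤ → ℤ × ℤ := P.corner δ (mu * P.leftEnd i + P.latX w) with hζ
  set K := (Finset.range (F 0 i + F 1 i)).filter fun k : ℕ => ω (0 + k) = j with hK
  have hle := P.leftEnd_mem_sideBase i
  have hmono : StrictMono fun n => P.latY (ζ n) := latY_corner_strictMono _ _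
  have hz0 : ζ 0 = 0 := E.corner_image_zero hw hle
  have hz1 : ζ (F 0 i + F 1 i : ℕ) = latAct F (latVec i) := E.corner_image_end hw hle
  have hsucc : ∀ n, P.latY (ζ (n + 1)) = P.latY (ζ n) + P.u (ω n) := fun n => by
    rw [hζ, corner_succ, P.latY_add, P.latY_latVec]
  have hKmem : ∀ k : K, (k : ℕ) < F 0 i + F 1 i ∧ ω (k : ℕ) = j := fun k => by
    have := Finset.mem_filter.1 k.2
    rwa [Finset.mem_range, zero_add] at this
  -- the heights of the strips in the image of the rectangle
  have hheight : ∀ k : K, 0 ≤ P.latY (ζ (k : ℕ)) ∧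
      P.latY (ζ (k : ℕ)) + P.u j ≤ lam * P.u i := by
    intro k
    obtain ⟨h1, h2⟩ := hKmem k
    have h3 := hmono.monotone (a := 0) (b := ((k : ℕ) : ℤ)) (by omega)
    have h4 := hmono.monotone (a := ((k : ℕ) : ℤ) + 1) (b := (F 0 i + F 1 i : ℕ)) (by omega)
    beta_reduce at h3 h4
    rw [hz0, P.latY_zero] at h3
    rw [hsucc, h2, hz1, E.latY_act_latVec] at h4
    exact ⟨h3, h4⟩
  have hslide : ∀ x ∈ P.base i, ∀ k : ℕ, k < F 0 i + F 1 i →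
      mu * x + P.latX w - P.latX (ζ k) ∈ P.base (ω k) := fun x hx k hk =>
    E.slide_corner hw (ε := true) hle hx (P.leftEnd_lt hx) hk
  -- the strip of the `k`-th tile, in the plane
  let A : K → Set (ℝ × ℝ) := fun k => ((fun x => mu * x) '' P.base i) ×ˢ
    Ioo (-(lam * τ) + P.latY (ζ (k : ℕ))) (-(lam * τ) + (P.latY (ζ (k : ℕ)) + P.u j))
  have hcount : ENat.card K = (Fᵀ i j : ℕ∞) := by
    rw [ENat.card_eq_coe_fintype_card, Fintype.card_coe, Matrix.transpose_apply,
      ← E.subst_hasMatrix hw j i, subst, count_factor]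
  rw [← hcount]
  refine card_connectedComponents_of_iUnion (fun k => P.proj '' A k) ?_ (fun k => ?_)
    (fun k => ?_) (fun k => ?_) ?_
  · ext a
    simp only [mem_inter_iff, mem_iUnion, interior_rect]
    constructor
    · rintro ⟨⟨_, ha, rfl⟩, hb⟩
      obtain ⟨⟨x, y⟩, ⟨hx, hy⟩, rfl⟩ := P.mem_place.1 ha
      obtain ⟨⟨x', y'⟩, ⟨hx', hy'⟩, he⟩ := P.mem_place.1 hb
      rw [E.toralMap_proj] at he ⊢
      obtain ⟨z, hz⟩ := P.proj_eq_iff.1 he.symm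
      simp only [Prod.mk_add_mk, Prod.mk.injEq, zero_add] at hz hx hy hx' hy' ⊢
      obtain ⟨hz1', hz2'⟩ := hz
      -- the tile of the partition that contains the point
      have e1 : x' = mu * x + P.latX w - P.latX (w - z) := by rw [P.latX_sub]; linarith
      have e2 : y' = lam * y - P.latY (w - z) := by rw [P.latY_sub, hτ]; linarith
      rw [e1] at hx'
      rw [e2] at hy'
      have hxi := P.base_subset_sideBase (imageSide mu true) i hx
      have hc := corner_eq (ε := true) rfl
        (P.sideBase_subset_sideSpine _ _ (P.base_subset_sideBase true j hx'))
      have hwd := word_eq (ε := true) rfl (P.base_subset_sideBase true j hx')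
      have hm := latY_corner_strictMono (P := P) true (mu * x + P.latX w)
      have c0 := E.corner_image_zero hw hxi
      have c1 := E.corner_image_end hw hxi
      rw [imageSide_imageSide] at c0 c1
      have hm0 : 0 ≤ latLen (w - z) := by
        have := (hm.lt_iff_lt (a := 0) (b := latLen (w - z) + 1)).1 (by
          rw [corner_succ, c0, hc, hwd, P.latY_add, P.latY_latVec, P.latY_zero]
          have := mul_pos l0 hy.1
          linarith [hy'.2])
        omega
      have hm1 : latLen (w - z) < (F 0 i + F 1 i : ℕ) := (hm.lt_iff_lt).1 (by
          rw [c1, hc, E.latY_act_latVec]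
          have := mul_lt_mul_of_pos_left hy.2 l0
          linarith [hy'.1])
      obtain ⟨k, hk⟩ := Int.eq_ofNat_of_zero_le hm0
      rw [hk] at hc hwd hm1
      have hk1 : k < F 0 i + F 1 i := by exact_mod_cast hm1
      have hsl := P.base_subset_sideBase true _ (hslide x hx k hk1)
      have hzk : ζ k = w - z := by
        rw [← hc]
        exact (corner_eq (P.latLen_corner _ _ _) (P.sideBase_subset_sideSpine _ _ hsl)).symm
      have hwk : ω k = j := by
        rw [← hwd]
        exact (word_eq (P.latLen_corner _ _ _) hsl).symm
      refine ⟨⟨k, Finset.mem_filter.2 ⟨Finset.mem_range.2 hk1, by rwa [zero_add]⟩⟩, _,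
        ⟨⟨x, hx, rfl⟩, ?_, ?_⟩, rfl⟩
      · simp only [hzk]; linarith [hy'.1]
      · simp only [hzk]; linarith [hy'.2]
    · rintro ⟨k, ⟨_, b⟩, ⟨⟨x, hx, rfl⟩, hb⟩, rfl⟩
      simp only at hb
      obtain ⟨h1, h2⟩ := hheight k
      obtain ⟨hk1, hk2⟩ := hKmem k
      have hsl := hslide x hx k hk1
      rw [hk2] at hsl
      constructor
      · refine ⟨P.proj ((0, -τ) + (x, (b + lam * τ) / lam)),
          P.mem_place.2 ⟨_, ⟨hx, ?_, ?_⟩, rfl⟩, ?_⟩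
        · exact div_pos (by linarith [hb.1]) l0
        · simp only
          rw [div_lt_iff₀ l0]; linarith [hb.2]
        · rw [E.toralMap_proj]
          congr 1
          simp only [Prod.mk_add_mk, zero_add, Prod.mk.injEq, true_and]
          field_simp
          ring
      · refine P.mem_place.2 ⟨(mu * x + P.latX w - P.latX (ζ (k : ℕ)),
          b + lam * τ - P.latY (ζ (k : ℕ))), ⟨hsl, ?_, ?_⟩, ?_⟩
        · simp only; linarith [hb.1]
        · simp only; linarith [hb.2]
        · rw [P.proj_eq_iff]
          refine ⟨ζ (k : ℕ) - w, ?_⟩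
          rw [P.latX_sub, P.latY_sub, hτ]
          ext
          · simp
          · simp; ring
  · exact QuotientAddGroup.isOpenMap_coe _
      (((isOpenMap_smul₀ hmu0) _ (P.isOpen_base i)).prod isOpen_Ioo)
  · refine IsPreconnected.image ?_ _ continuous_quotient_mk'.continuousOn
    exact ((P.isPreconnected_base i).image _ (by fun_prop)).prod isPreconnected_Ioo
  · exact (((P.base_nonempty i).image _).prod
      (nonempty_Ioo.2 (by linarith [P.u_pos j]))).image _
  · rintro k k' ⟨_, ⟨⟨_, b⟩, ⟨⟨x, hx, rfl⟩, hb⟩, rfl⟩, ⟨⟨_, b'⟩, ⟨⟨x', hx', rfl⟩, hb'⟩, he⟩⟩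
    simp only at hb hb'
    obtain ⟨z, hz⟩ := P.proj_eq_iff.1 he.symm
    simp only [Prod.mk_add_mk, Prod.mk.injEq] at hz
    obtain ⟨v, hvx, hvy⟩ := E.exists_preimage z
    obtain ⟨h1, h2⟩ := hheight k
    obtain ⟨h1', h2'⟩ := hheight k'
    have hv : v = 0 := by
      refine P.latVec_eq_zero_of_base hx hx' ?_ ?_ ?_
      · apply mul_left_cancel₀ hmu0; linarith [hz.1]
      · refine lt_of_mul_lt_mul_left ?_ l0.le
        linarith [hz.2, hb.1, hb.2, hb'.1, hb'.2]
      · refine lt_of_mul_lt_mul_left ?_ l0.le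
        linarith [hz.2, hb.1, hb.2, hb'.1, hb'.2]
    rw [hv, P.latY_zero, mul_zero] at hvy
    have hbb : b' = b := by linarith [hz.2]
    subst hbb
    obtain ⟨-, e1⟩ := hKmem k
    obtain ⟨-, e2⟩ := hKmem k'
    have key : ∀ m m' : ℕ, ω m = j → m < m' → P.latY (ζ m) + P.u j ≤ P.latY (ζ m') := by
      intro m m' hm hlt
      have := hmono.monotone (a := (m : ℤ) + 1) (b := m') (by omega)
      beta_reduce at this
      rwa [hsucc, hm] at this
    refine Subtype.ext (le_antisymm ?_ ?_) <;> by_contra hcon <;> rw [not_le] at hcon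
    · linarith [key _ _ e2 hcon, hb.1, hb'.2]
    · linarith [key _ _ e1 hcon, hb.2, hb'.1]

end IsEigen

end BiPartition

theorem mainTheorem4 (F : Matrix (Fin 2) (Fin 2) ℕ)
    (hdet : IsUnit (F.map (fun x : ℕ => (x : ℤ))).det)
    (hhyp : IsHyperbolicMatrix F)
    (P : BiPartition)
    (hs : ∃ c : ℝ, (F.map (fun x : ℕ => (x : ℝ))) *ᵥ P.s = c • P.s)
    (hu : ∃ c : ℝ, P.u ᵥ* (F.map (fun x : ℕ => (x : ℝ))) = c • P.u) :
    ∃ (t : Fin (F 0 0 + F 0 1 + F 1 0 + F 1 1 - 1) → ℝ)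
      (σ : Fin (F 0 0 + F 0 1 + F 1 0 + F 1 1 - 1) → Substitution),
      -- the admissible positions `(0, t i)` of the origin in the vertical spine
      StrictMono t ∧
      Set.range t = {τ : ℝ | τ ∈ Set.Icc 0 (P.u 0 + P.u 1) ∧ P.IsBerg F (0, -τ)} ∧
      (∀ i, P.HasConnectivityMatrix F (0, -t i) Fᵀ) ∧
      -- the substitution that belongs to each of these Berg partitions
      (∀ i σ', P.Realizes F (0, -t i) σ' ↔ σ' = σ i) ∧
      Function.Injective σ ∧
      -- the window of the principal tiling that is split into the two words
      (∀ ω, P.IsTiling 0 ω →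
        ω 0 = (if (F.map (fun x : ℕ => (x : ℤ))).det = 1 then 0 else 1) →
        ∀ i, σ i 0 = factor ω (-(i : ℕ)) (F 0 0 + F 1 0) ∧
          σ i 1 = factor ω (-(i : ℕ) + (F 0 0 + F 1 0 : ℕ)) (F 0 1 + F 1 1)) ∧
      -- cyclic permutations of the words of the standard substitution
      (∃ σ₀, P.IsStandard F σ₀ ∧ ∀ i j, (σ i j).rotate i = σ₀ j) ∧
      -- the tiling through the point `x` of the spine goes to the tiling through its image `x'`
      (∀ i x ω, P.IsTiling x ω → ∃ x' ω',
        P.toralMap F (P.proj ((0, -t i) + (x, 0))) = P.proj ((0, -t i) + (x', 0)) ∧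
          (σ i).IsImage ω ω' ∧ P.IsTiling x' ω') ∧
      -- the principal tilings are preserved, up to the shift and the lock
      (∀ i ω, P.IsTiling 0 ω → ∃ ω', P.IsTiling 0 ω' ∧
        (ω' 0 = ω 0 ↔ (F.map (fun x : ℕ => (x : ℤ))).det = 1) ∧
          (σ i).IsImage ω fun n => ω' (n - (i : ℕ))) ∧
      -- every substitution with the matrix `F` that preserves a Sturmian word is one of these
      Set.range σ = {σ' : Substitution | σ'.HasMatrix F ∧
        ∃ ω ∈ P.tilings, ∃ ω' ∈ P.tilings, σ'.IsRightImage ω ω'} := by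
  obtain ⟨lam, mu, E⟩ := P.exists_isEigen F hdet hhyp hs hu
  have l1 := E.one_lt
  have hl : 0 < lam - 1 := by linarith
  set N := F 0 0 + F 0 1 + F 1 0 + F 1 1 - 1 with hN
  set w : ℕ → ℤ × ℤ := fun i => -P.corner true 0 (-i) with hw
  have hlen : ∀ i, latLen (w i) = i := fun i => by
    rw [hw, latLen_neg, P.latLen_corner, neg_neg]
  have hadm : ∀ i : Fin N, P.Admissible lam mu (w i) := fun i =>
    (E.admissible_neg_corner_iff i).2 ⟨by omega, by exact_mod_cast i.2⟩
  have hall : ∀ v, P.Admissible lam mu v → ∃ i : Fin N, w i = v := by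
    intro v hv
    have hv' : v = -P.corner true 0 (-latLen v) := by
      rw [hv.corner_neg E.mu_ne_zero, neg_neg]
    rw [hv'] at hv
    obtain ⟨h0, h1⟩ := (E.admissible_neg_corner_iff _).1 hv
    obtain ⟨n, hn⟩ := Int.eq_ofNat_of_zero_le h0
    rw [hn] at h1 hv'
    exact ⟨⟨n, by exact_mod_cast h1⟩, hv'.symm⟩
  set t : Fin N → ℝ := fun i => P.latY (w i) / (lam - 1) with ht
  have hτ : ∀ i : Fin N, P.latY (w i) = (lam - 1) * t i := fun i => by
    rw [ht]; field_simp
  refine ⟨t, fun i => P.subst F mu (w i), ?_, ?_, fun i => E.hasConnectivityMatrix (hadm i) (hτ i),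
    fun i σ' => E.realizes_iff (hadm i) (hτ i), ?_, ?_, ⟨P.subst F mu 0, E.isStandard_subst,
    fun i j => E.rotate_subst i.2 j⟩, ?_, ?_, ?_⟩
  · intro i j hij
    refine div_lt_div_of_pos_right ?_ hl
    have := BiPartition.latY_corner_strictMono (P := P) true 0 (a := -((j : ℕ) : ℤ))
      (b := -((i : ℕ) : ℤ)) (by have : (i : ℕ) < j := hij; omega)
    beta_reduce at this
    rw [hw, P.latY_neg, P.latY_neg]
    linarith
  · ext τ
    constructor
    · rintro ⟨i, rfl⟩
      have hi : t i ∈ Icc 0 (P.u 0 + P.u 1) :=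
        ⟨div_nonneg (hadm i).nonneg hl.le, (div_le_iff₀' hl).2 (hadm i).le⟩
      exact ⟨hi, (E.isBerg_iff hi).2 ⟨w i, hadm i, hτ i⟩⟩
    · rintro ⟨hi, hB⟩
      obtain ⟨v, hv, hvτ⟩ := (E.isBerg_iff hi).1 hB
      obtain ⟨i, rfl⟩ := hall v hv
      exact ⟨i, mul_left_cancel₀ hl.ne' ((hτ i).symm.trans hvτ)⟩
  · intro i j hij
    have := congrArg latLen (E.subst_injective (hadm i) (hadm j) hij)
    rw [hlen, hlen] at this
    exact Fin.ext (by exact_mod_cast this)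
  · intro ω hω h0 i
    obtain ⟨ε, -, rfl⟩ := hω.exists_word E.latX_injective E.latY_injective
    -- the lock of the tiling singles out its side
    have hε : ε = BiPartition.imageSide mu true := by
      apply P.word_zero_inj
      rw [h0]
      rcases lt_or_gt_of_ne E.mu_ne_zero with hmu | hmu
      · rw [if_neg (mt E.det_eq_one_iff.1 hmu.not_gt), BiPartition.imageSide_of_neg hmu]
        exact P.word_false_zero.symm
      · rw [if_pos (E.det_eq_one_iff.2 hmu), BiPartition.imageSide_of_pos hmu]
        exact P.word_true_zero.symm
    rw [hε]
    beta_reduce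
    rw [BiPartition.IsEigen.subst_zero_eq, E.subst_one_eq, hlen]
    exact ⟨rfl, rfl⟩
  · intro i x ω hω
    obtain ⟨ε, hx, rfl⟩ := hω.exists_word E.latX_injective E.latY_injective
    exact ⟨mu * x + P.latX (w i), _, E.toralMap_spine (hτ i) x, E.subst_isImage (hadm i) hx,
      .of_word ((hadm i).maps_sideSpine E.mu_ne_zero hx)⟩
  · intro i ω hω
    obtain ⟨ε, hx, rfl⟩ := hω.exists_word E.latX_injective E.latY_injective
    refine ⟨P.word (BiPartition.imageSide mu ε) 0, .of_word (P.zero_mem_sideSpine _), ?_, ?_⟩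
    · rw [E.det_eq_one_iff]
      rcases lt_or_gt_of_ne E.mu_ne_zero with hmu | hmu
      · rw [BiPartition.imageSide_of_neg hmu]
        refine iff_of_false (fun h => ?_) hmu.not_gt
        have := P.word_zero_inj h
        cases ε <;> simp at this
      · rw [BiPartition.imageSide_of_pos hmu]
        exact iff_of_true rfl hmu
    · have h := E.subst_isImage (hadm i) hx
      rw [mul_zero, zero_add] at h
      convert h using 1
      funext n
      rw [BiPartition.word_latX, hlen]
  · ext σ'
    constructor
    · rintro ⟨i, rfl⟩
      have h0 := P.zero_mem_sideSpine true
      exact ⟨E.subst_hasMatrix (hadm i), _, ⟨0, .of_word h0⟩, _,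
        ⟨_, .of_word ((hadm i).maps_sideSpine E.mu_ne_zero h0)⟩,
        (E.subst_isImage (hadm i) h0).isRightImage⟩
    · rintro ⟨hσ, ω, ⟨y, hω⟩, ω', ⟨y', hω'⟩, h⟩
      obtain ⟨ε, hy, rfl⟩ := hω.exists_word E.latX_injective E.latY_injective
      obtain ⟨ε', hy', rfl⟩ := hω'.exists_word E.latX_injective E.latY_injective
      obtain ⟨v, hv, rfl⟩ := E.exists_eq_subst hσ h hy hy'
      obtain ⟨i, rfl⟩ := hall v hv
      exact ⟨i, rfl⟩
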